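/- Let $X$ be a separable real Hilbert space and let $A:D(A)\subset X\to X$ be densely defined, self-adjoint, with $\langle Ax,x\rangle\ge 0$ for all $x\in D(A)$ and with $(cI+A)^{-1}:X\to X$ compact for some $c>0$. Let $P_\mu$ be the orthogonal projection onto the eigenspace of $A$ for $\mu$, and put $e^{-tA}x=\sum_\mu e^{-\mu t}P_\mu x$, $A^{1/2}x=\sum_\mu \mu^{1/2}P_\mu x$ (sums over the eigenvalues of $A$), $D(A^{1/2})=\{x:\sum_\mu \mu\|P_\mu x\|^2<\infty\}$ and $\|x\|_{1/2}=(\|x\|^2+\|A^{1/2}x\|^2)^{1/2}$. Let $\lambda_1\ge 0$ be the smallest eigenvalue of $A$, $\varphi_1$ an associated eigenvector with $\|\varphi_1\|=1$, and $\psi_1(t)=e^{-\lambda_1t}\varphi_1$. Let $B:D(B)\subset X\to X$ be a linear (possibly unbounded) operator with $D(A^{1/2})\subset D(B)$ and $\|B\varphi\|\le C_B\|\varphi\|_{1/2}$ for all $\varphi\in D(A^{1/2})$, where $C_B>0$. For $y_0\in X$, $p\in L^2(0,T)$ let $y(T;y_0,p)=e^{-TA}y_0-\int_0^Te^{-(T-s)A}p(s)B\varphi_1\,ds$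 be the value at time $T$ of the mild solution of $y'+Ay+p(t)B\varphi_1=0$, $y(0)=y_0$. Assume that $\{A,B\}$ is $1$-null controllable in every time $T>0$, i.e. for every $T>0$ there is $N_T>0$ such that for each $y_0\in X$ there is $p\in L^2(0,T)$ with $\|p\|_{L^2(0,T)}\le N_T\|y_0\|$ and $y(T;y_0,p)=0$. Assume also that for some $\nu,T_0>0$ the control cost $$N(\tau)=\sup_{\|y_0\|=1}\inf\{\|p\|_{L^2(0,\tau)}: y(\tau;y_0,p)=0\}$$ satisfies $N(\tau)\le e^{\nu/\tau}$ for all $0<\tau\le T_0$. Set $$D=2\sqrt2\,C_B\,e^{C_B(\frac54C_B+1)+1}\Big(\max\Big\{1+\tfrac32C_B^2,\ \tfrac{C_B^2}{2}(1+\lambda_1^{1/2})^2(5+3C_B^2)\Big\}\Big)^{1/2},\qquad \Gamma_0=2\nu+3\lambda_1+\max\{\log D,0\},$$ and, for $T>0$, $T_1=\min\{\frac{6}{\pi^2}T,1,T_0\}$ and $R_T=e^{-6\Gamma_0/T_1}>0$. Then for every $T>0$ and every $u_0\in D(A^{1/2})$ with $\|u_0-\varphi_1\|_{1/2}<R_T$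 there is a control $p\in L^2(0,T)$ with $$\|p\|_{L^2(0,T)}^2\le \frac{e^{-\pi^2\Gamma_0/T}}{e^{2\pi^2\Gamma_0/(3T)}-1}$$ such that the problem $u'+Au+p(t)Bu=0$ on $[0,T]$, $u(0)=u_0$, has a mild solution, i.e. a function $u\in C([0,T];D(A^{1/2}))$ with $u(t)=e^{-tA}u_0-\int_0^te^{-(t-s)A}p(s)Bu(s)\,ds$ for all $t\in[0,T]$, and every such mild solution satisfies $u(T)=\psi_1(T)$. -/

import Mathlib

open MeasureTheory Set
open scoped ENNReal

noncomputable section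

namespace BilinearControl

variable {X : Type*} [NormedAddCommGroup X] [InnerProductSpace ℝ X] [CompleteSpace X]

/-- The space `L²(0,T)` of scalar controls, with its usual norm. -/
abbrev L2 (T : ℝ) : Type := Lp ℝ 2 (volume.restrict (Ioo (0 : ℝ) T))

/-- The action of an unbounded operator, extended by `0` outside of its domain
(it is only used at points of the domain). -/
def opApply (B : X →ₗ.[ℝ] X) (x : X) : X :=
  open Classical in if h : x ∈ B.domain then B ⟨x, h⟩ else 0

/-- `A` is densely defined, self-adjoint, nonnegative, and has compact resolvent:
for some `c > 0` the operator `c I + A : D(A) → X` has a compact everywhere defined inverse. -/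
structure IsNonnegSelfAdjointCompactResolvent (A : X →ₗ.[ℝ] X) : Prop where
  dense : Dense (A.domain : Set X)
  selfAdjoint : IsSelfAdjoint A
  nonneg : ∀ x : A.domain, 0 ≤ inner ℝ (A x) (x : X)
  compactResolvent : ∃ c : ℝ, 0 < c ∧ ∃ R : X →L[ℝ] X, IsCompactOperator R ∧
    (∀ x : X, ∃ h : R x ∈ A.domain, c • R x + A ⟨R x, h⟩ = x) ∧
    (∀ x : A.domain, R (c • (x : X) + A x) = x)

/-- The eigenspace `{x ∈ D(A) : A x = μ x}`. -/
def eigenspace (A : X →ₗ.[ℝ] X) (μ : ℝ) : Submodule ℝ X where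
  carrier := {x | ∃ h : x ∈ A.domain, A ⟨x, h⟩ = μ • x}
  add_mem' := by
    rintro x y ⟨hx, ex⟩ ⟨hy, ey⟩
    refine ⟨A.domain.add_mem hx hy, ?_⟩
    have := A.map_add ⟨x, hx⟩ ⟨y, hy⟩
    rw [ex, ey, ← smul_add] at this
    exact this
  zero_mem' := ⟨A.domain.zero_mem, by
    have := A.map_zero
    rw [smul_zero]
    exact this⟩
  smul_mem' := by
    rintro c x ⟨hx, ex⟩
    refine ⟨A.domain.smul_mem c hx, ?_⟩
    have := A.map_smul c ⟨x, hx⟩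
    rw [ex, smul_comm] at this
    exact this

/-- The orthogonal projection of `X` onto the eigenspace of `μ`
(this space is closed when `A` is closed; it is `{0}` if `μ` is not an eigenvalue). -/
def eigenProj (A : X →ₗ.[ℝ] X) (μ : ℝ) : X →L[ℝ] X :=
  (eigenspace A μ).topologicalClosure.starProjection

/-- The domain `{x : ∑ |f μ|² ‖P_μ x‖² < ∞}` of `f(A)`, the sum being over the eigenvalues of `A`. -/
def spectralDomain (A : X →ₗ.[ℝ] X) (f : ℝ → ℝ) : Set X :=
  {x | Summable fun μ : ℝ => f μ ^ 2 * ‖eigenProj A μ x‖ ^ 2}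

/-- `f(A) x = ∑ f(μ) P_μ x`, the sum being over the eigenvalues of `A`. With an orthonormal basis
of eigenvectors, `A φₖ = λₖ φₖ`, this is `∑ₖ f(λₖ) ⟨x, φₖ⟩ φₖ`. -/
def spectralOp (A : X →ₗ.[ℝ] X) (f : ℝ → ℝ) (x : X) : X :=
  ∑' μ : ℝ, f μ • eigenProj A μ x

/-- The domain of `A^{1/2}`. -/
def sqrtDomain (A : X →ₗ.[ℝ] X) : Set X := spectralDomain A Real.sqrt

/-- The operator `A^{1/2}`. -/
def sqrtOp (A : X →ₗ.[ℝ] X) (x : X) : X := spectralOp A Real.sqrt x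

/-- The norm `‖x‖_{1/2} = (‖x‖² + ‖A^{1/2} x‖²)^{1/2}` of `D(A^{1/2})`. -/
def halfNorm (A : X →ₗ.[ℝ] X) (x : X) : ℝ := Real.sqrt (‖x‖ ^ 2 + ‖sqrtOp A x‖ ^ 2)

/-- The semigroup `e^{-tA}`, `t ≥ 0`. -/
def semigroup (A : X →ₗ.[ℝ] X) (t : ℝ) (x : X) : X := spectralOp A (fun μ => Real.exp (-(μ * t))) x

/-- The value at time `T` of the mild solution of `y' + A y + p(t) b = 0`, `y(0) = y₀`. -/
def linearSolutionAt (A : X →ₗ.[ℝ] X) (b : X) (T : ℝ) (y₀ : X) (p : L2 T) : X :=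
  semigroup A T y₀ - ∫ s in (0 : ℝ)..T, semigroup A (T - s) (p s • b)

/-- Null controllability in time `T` of `y' + A y + p(t) b = 0`, with a control whose norm is
bounded by a constant times the norm of the initial state. For `b = B φ₁` this is the
`1`-null controllability of the pair `{A, B}`. -/
def NullControllable (A : X →ₗ.[ℝ] X) (b : X) (T : ℝ) : Prop :=
  ∃ N : ℝ, 0 < N ∧ ∀ y₀ : X, ∃ p : L2 T, ‖p‖ ≤ N * ‖y₀‖ ∧ linearSolutionAt A b T y₀ p = 0

/-- The control cost `N(T) = sup_{‖y₀‖ = 1} inf {‖p‖ : y(T; y₀, p) = 0}`. -/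
def controlCost (A : X →ₗ.[ℝ] X) (b : X) (T : ℝ) : ℝ≥0∞ :=
  ⨆ (y₀ : X) (_ : ‖y₀‖ = 1), ⨅ (p : L2 T) (_ : linearSolutionAt A b T y₀ p = 0), ‖p‖ₑ

/-- `u ∈ C([0,T]; D(A^{1/2}))` is the mild solution on `[0,T]` of
`u' + A u + p(t) B u = 0`, `u(0) = u₀`. -/
structure IsMildSolution (A B : X →ₗ.[ℝ] X) (T : ℝ) (u₀ : X) (p : L2 T) (u : ℝ → X) : Prop where
  mem : ∀ t ∈ Icc 0 T, u t ∈ sqrtDomain A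
  cont : ContinuousOn u (Icc 0 T)
  cont_sqrt : ContinuousOn (fun t => sqrtOp A (u t)) (Icc 0 T)
  eq : ∀ t ∈ Icc 0 T, u t = semigroup A t u₀ -
    ∫ s in (0 : ℝ)..t, semigroup A (t - s) (p s • opApply B (u s))

/-- The constant `D`. -/
def constD (CB lam : ℝ) : ℝ :=
  2 * Real.sqrt 2 * CB * Real.exp (CB * (5 / 4 * CB + 1) + 1) *
    Real.sqrt (max (1 + 3 / 2 * CB ^ 2)
      (CB ^ 2 / 2 * (1 + Real.sqrt lam) ^ 2 * (5 + 3 * CB ^ 2)))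

/-- The constant `Γ₀ = 2ν + 3λ₁ + max {log D, 0}`. -/
def constGamma (ν CB lam : ℝ) : ℝ := 2 * ν + 3 * lam + max (Real.log (constD CB lam)) 0

/-- The time `T₁ = min {6T/π², 1, T₀}`. -/
def timeT1 (T T₀ : ℝ) : ℝ := min (6 / Real.pi ^ 2 * T) (min 1 T₀)

/-- The radius `R_T = exp(-6 Γ₀ / T₁)`. -/
def radius (ν T₀ CB lam T : ℝ) : ℝ := Real.exp (-(6 * constGamma ν CB lam / timeT1 T T₀))

end BilinearControl

end

/-! The substitution z = (1 + A)^{1/2} u replaces B by the bounded operator C = B (1 + A)^{-1/2} and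
moves the lost half derivative into the scalar Duhamel kernel of each spectral mode. After the shift
by λ₁, the square of that kernel has integral at most (1 + λ₁)ℓ + 1/2 over an interval of length ℓ,
uniformly in μ ≥ λ₁. Summing over modes, an L² forcing therefore yields a bounded z
(`norm_sq_le_of_modes`). In a norm weighted by exp(κ ∫ p²) the Picard map halves distances
(`weighted_contraction`), which gives existence and uniqueness for every p in L².

Put ζ = (1 + λ₁)^{1/2} φ₁ and v = e^{λ₁ t} z − ζ, so that the target is v = 0. On [a, b], take a
control that steers the linearization from v(a) to zero. All that survives at time b is the Duhamel
integral of −p C v, a product of two small quantities. Since ‖p‖ is bounded by the control cost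
times ‖v(a)‖, the new deviation is of order (cost)² ‖v(a)‖² (`norm_step_le`).

This is iterated, as in Newton's method, on intervals of length T₁/(n+1)², where the cost is about
exp(ν(n+1)²/T₁). Quadratic convergence beats this growth: with q_n = n² + 4n + 6 one has q_{n+1} = 2
q_n − (n+1)², and ‖v‖ ≤ exp(−q_n Γ₀/T₁) propagates (`step_bounds`). The interval lengths add up to
T₁π²/6 ≤ T, where v vanishes by continuity, and it stays zero once the control is switched off. The
squared norms of the pieces are dominated by a geometric series whose sum is the stated bound
(`exists_control`). -/

namespace BilinearControl

open Filter Topology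

/-! ### Functional calculus for a complete family of orthogonal projections. -/

section

variable {X : Type*} [NormedAddCommGroup X] [InnerProductSpace ℝ X]

/-- A complete family of pairwise orthogonal orthogonal projections. -/
structure SpectralFamily (P : ℝ → X →L[ℝ] X) : Prop where
  idem : ∀ μ x, P μ (P μ x) = P μ x
  orth : ∀ μ ν x, μ ≠ ν → P μ (P ν x) = 0
  symm : ∀ μ x y, inner ℝ (P μ x) y = inner ℝ x (P μ y)
  total : ∀ x, (∀ μ, P μ x = 0) → x = 0

namespace SpectralFamily

variable {P : ℝ → X →L[ℝ] X}

theorem ext (hP : SpectralFamily P) {x y : X} (h : ∀ μ, P μ x = P μ y) : x = y :=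
  sub_eq_zero.1 <| hP.total _ fun μ => by rw [map_sub, h μ, sub_self]

theorem orthogonalFamily (hP : SpectralFamily P) :
    OrthogonalFamily ℝ (fun μ => (P μ).range) fun μ => (P μ).range.subtypeₗᵢ := by
  rintro μ ν hμν ⟨_, x, rfl⟩ ⟨_, y, rfl⟩
  change inner ℝ (P μ x) (P ν y) = 0
  rw [hP.symm, hP.orth μ ν y hμν, inner_zero_right]

theorem norm_sum_sq (hP : SpectralFamily P) {c : ℝ → X} (hc : ∀ μ, P μ (c μ) = c μ)
    (s : Finset ℝ) : ‖∑ μ ∈ s, c μ‖ ^ 2 = ∑ μ ∈ s, ‖c μ‖ ^ 2 :=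
  hP.orthogonalFamily.norm_sum (fun μ => ⟨c μ, c μ, hc μ⟩) s

theorem summable (hP : SpectralFamily P) [CompleteSpace X] {c : ℝ → X}
    (hc : ∀ μ, P μ (c μ) = c μ) (hs : Summable fun μ => ‖c μ‖ ^ 2) : Summable c :=
  (hP.orthogonalFamily.summable_iff_norm_sq_summable (fun μ => ⟨c μ, c μ, hc μ⟩)).2 hs

theorem hasSum_norm_sq (hP : SpectralFamily P) {c : ℝ → X}
    (hc : ∀ μ, P μ (c μ) = c μ) (hs : Summable c) :
    HasSum (fun μ => ‖c μ‖ ^ 2) (‖∑' μ, c μ‖ ^ 2) := by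
  have h : Tendsto (fun s : Finset ℝ => ‖∑ μ ∈ s, c μ‖ ^ 2) atTop (𝓝 (‖∑' μ, c μ‖ ^ 2)) :=
    (hs.hasSum.norm).pow 2
  simpa only [HasSum, hP.norm_sum_sq hc] using! h

theorem apply_tsum (hP : SpectralFamily P) {c : ℝ → X}
    (hc : ∀ μ, P μ (c μ) = c μ) (hs : Summable c) (μ : ℝ) : P μ (∑' ν, c ν) = c μ := by
  rw [(P μ).map_tsum hs, tsum_eq_single μ, hc]
  intro ν hν
  rw [← hc ν, hP.orth μ ν _ hν.symm]

/-- Bessel's inequality: the partial sum S satisfies ‖S‖² = ⟨S, x⟩ ≤ ‖S‖ ‖x‖. -/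
theorem sum_norm_sq_le (hP : SpectralFamily P) (x : X) (s : Finset ℝ) :
    ∑ μ ∈ s, ‖P μ x‖ ^ 2 ≤ ‖x‖ ^ 2 := by
  have h1 := hP.norm_sum_sq (c := fun μ => P μ x) (fun μ => hP.idem μ x) s
  have h2 : inner ℝ (∑ μ ∈ s, P μ x) x = ∑ μ ∈ s, ‖P μ x‖ ^ 2 := by
    rw [sum_inner]
    refine Finset.sum_congr rfl fun μ _ => ?_
    rw [← real_inner_self_eq_norm_sq, hP.symm μ x (P μ x), hP.idem, hP.symm]
  have h3 := real_inner_le_norm (∑ μ ∈ s, P μ x) x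
  rw [h2, ← h1] at h3
  rw [← h1]
  nlinarith [norm_nonneg (∑ μ ∈ s, P μ x), norm_nonneg x]

theorem summable_norm_sq (hP : SpectralFamily P) (x : X) : Summable fun μ => ‖P μ x‖ ^ 2 :=
  summable_of_sum_le (fun _ => by positivity) (hP.sum_norm_sq_le x)

variable [CompleteSpace X]

theorem summable_apply (hP : SpectralFamily P) (x : X) : Summable fun μ => P μ x :=
  hP.summable (fun μ => hP.idem μ x) (hP.summable_norm_sq x)

theorem tsum_apply (hP : SpectralFamily P) (x : X) : ∑' μ, P μ x = x :=
  hP.ext fun μ => hP.apply_tsum (fun μ => hP.idem μ x) (hP.summable_apply x) μ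

theorem hasSum_norm_sq_apply (hP : SpectralFamily P) (x : X) :
    HasSum (fun μ => ‖P μ x‖ ^ 2) (‖x‖ ^ 2) := by
  simpa only [hP.tsum_apply] using
    hP.hasSum_norm_sq (fun μ => hP.idem μ x) (hP.summable_apply x)

/-- Vectors with prescribed square summable components. -/
theorem exists_of_summable (hP : SpectralFamily P) {c : ℝ → X}
    (hc : ∀ μ, P μ (c μ) = c μ) (hs : Summable fun μ => ‖c μ‖ ^ 2) :
    ∃ x, ∀ μ, P μ x = c μ :=
  ⟨_, hP.apply_tsum hc (hP.summable hc hs)⟩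

theorem norm_sq_le_of_sum_le (hP : SpectralFamily P) {x : X} {b : ℝ}
    (h : ∀ s : Finset ℝ, ∑ μ ∈ s, ‖P μ x‖ ^ 2 ≤ b) : ‖x‖ ^ 2 ≤ b :=
  le_of_tendsto' (hP.hasSum_norm_sq_apply x) h

theorem norm_le_of_forall (hP : SpectralFamily P) {x y : X} (h : ∀ μ, ‖P μ x‖ ≤ ‖P μ y‖) :
    ‖x‖ ≤ ‖y‖ := by
  refine le_of_sq_le_sq ?_ (norm_nonneg _)
  exact hasSum_le (fun μ => pow_le_pow_left₀ (norm_nonneg _) (h μ) 2)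
    (hP.hasSum_norm_sq_apply x) (hP.hasSum_norm_sq_apply y)

/-- Bounded functional calculus. -/
theorem exists_multiplier (hP : SpectralFamily P) {f : ℝ → ℝ}
    (hf : ∀ μ, P μ ≠ 0 → |f μ| ≤ 1) :
    ∃ M : X →L[ℝ] X, (∀ μ x, P μ (M x) = f μ • P μ x) ∧ ∀ x, ‖M x‖ ≤ ‖x‖ := by
  have hb : ∀ μ x, ‖f μ • P μ x‖ ≤ ‖P μ x‖ := fun μ x => by
    by_cases h : P μ = 0
    · simp [h]
    · rw [norm_smul]
      exact mul_le_of_le_one_left (norm_nonneg _) (hf μ h)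
  have hex : ∀ x, ∃ y, ∀ μ, P μ y = f μ • P μ x := fun x =>
    hP.exists_of_summable (fun μ => by rw [map_smul, hP.idem]) <|
      (hP.summable_norm_sq x).of_nonneg_of_le (fun _ => by positivity) fun μ =>
        pow_le_pow_left₀ (norm_nonneg _) (hb μ x) 2
  choose m hm using hex
  have hnorm : ∀ x, ‖m x‖ ≤ ‖x‖ := fun x =>
    hP.norm_le_of_forall fun μ => by rw [hm]; exact hb μ x
  let L : X →ₗ[ℝ] X :=
    { toFun := m
      map_add' := fun x y => hP.ext fun μ => by simp [hm]
      map_smul' := fun r x => hP.ext fun μ => by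
        rw [hm, map_smul, RingHom.id_apply, map_smul, hm, smul_comm] }
  exact ⟨L.mkContinuous 1 fun x => by rw [one_mul]; exact hnorm x, fun μ x => hm x μ, hnorm⟩

/-- A function is continuous if its components are continuous and are dominated, uniformly,
by a square summable family. -/
theorem continuousOn (hP : SpectralFamily P) {α : Type*} [TopologicalSpace α] {K : Set α}
    {u : α → X} {b : ℝ → ℝ} (hb : Summable b)
    (hc : ∀ μ, ContinuousOn (fun t => P μ (u t)) K)
    (hu : ∀ μ, ∀ t ∈ K, ‖P μ (u t)‖ ^ 2 ≤ b μ) : ContinuousOn u K := by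
  -- The squared norm of the remainder is at most the tail of `b`, which does not depend on `t`;
  -- hence the convergence is uniform.
  have hlim : TendstoUniformlyOn (fun (s : Finset ℝ) t => ∑ μ ∈ s, P μ (u t)) u atTop K := by
    rw [Metric.tendstoUniformlyOn_iff]
    intro ε hε
    have h0 := (tendsto_order.1 (tendsto_tsum_compl_atTop_zero b)).2 (ε ^ 2) (by positivity)
    filter_upwards [h0] with s hs t ht
    rw [dist_eq_norm]
    refine lt_of_pow_lt_pow_left₀ 2 hε.le (lt_of_le_of_lt ?_ hs)
    classical
    have hcomp : ∀ μ, P μ (u t - ∑ ν ∈ s, P ν (u t)) = if μ ∈ s then 0 else P μ (u t) := by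
      intro μ
      rw [map_sub, map_sum]
      split_ifs with h
      · rw [Finset.sum_eq_single_of_mem μ h fun ν _ hν => hP.orth μ ν _ hν.symm, hP.idem, sub_self]
      · rw [Finset.sum_eq_zero fun ν hν => hP.orth μ ν _ fun h' => h (h' ▸ hν), sub_zero]
    refine hP.norm_sq_le_of_sum_le fun F => ?_
    have hb0 : ∀ μ, 0 ≤ b μ := fun μ => le_trans (by positivity) (hu μ t ht)
    have hsb : Summable ({μ | μ ∉ s}.indicator b) := hb.indicator _
    have htail : ∑' μ : {μ // μ ∉ s}, b μ = ∑' μ, {μ | μ ∉ s}.indicator b μ :=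
      tsum_subtype {μ | μ ∉ s} b
    rw [htail]
    refine le_trans (Finset.sum_le_sum fun μ _ => ?_)
      (hsb.sum_le_tsum F fun μ _ => indicator_nonneg (fun μ _ => hb0 μ) μ)
    rw [hcomp]
    by_cases h : μ ∈ s
    · simp [h]
    · simpa [h] using hu μ t ht
  exact hlim.continuousOn (Frequently.of_forall fun s => continuousOn_finsetSum s fun μ _ => hc μ)

end SpectralFamily

end

/-! ### The eigenprojections of A form a complete family. -/

section

variable {X : Type*} [NormedAddCommGroup X] [InnerProductSpace ℝ X] [CompleteSpace X]

section Eigenspaces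

variable {A : X →ₗ.[ℝ] X}

theorem IsNonnegSelfAdjointCompactResolvent.inner_comm
    (hA : IsNonnegSelfAdjointCompactResolvent A) (x y : A.domain) :
    inner ℝ (A x) (y : X) = inner ℝ (x : X) (A y) := by
  have h := LinearPMap.adjoint_isFormalAdjoint hA.dense
  rw [LinearPMap.isSelfAdjoint_def.1 hA.selfAdjoint] at h
  exact h x y

theorem IsNonnegSelfAdjointCompactResolvent.isOrtho_eigenspace
    (hA : IsNonnegSelfAdjointCompactResolvent A) {μ ν : ℝ} (hμν : μ ≠ ν) :
    eigenspace A μ ⟂ eigenspace A ν := by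
  rw [Submodule.isOrtho_iff_inner_eq]
  rintro x ⟨hx, ex⟩ y ⟨hy, ey⟩
  have h := hA.inner_comm ⟨x, hx⟩ ⟨y, hy⟩
  simp only [ex, ey, inner_smul_left, inner_smul_right] at h
  have h' : (μ - ν) * inner ℝ x y = 0 := by
    rw [sub_mul, sub_eq_zero]
    simpa using h
  exact (mul_eq_zero.1 h').resolve_left (sub_ne_zero.2 hμν)

theorem IsNonnegSelfAdjointCompactResolvent.isOrtho_closure
    (hA : IsNonnegSelfAdjointCompactResolvent A) {μ ν : ℝ} (hμν : μ ≠ ν) :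
    (eigenspace A μ).topologicalClosure ⟂ (eigenspace A ν).topologicalClosure := by
  have h1 : (eigenspace A μ).topologicalClosure ⟂ eigenspace A ν :=
    Submodule.topologicalClosure_minimal _ (hA.isOrtho_eigenspace hμν)
      (Submodule.isClosed_orthogonal _)
  have h2 : (eigenspace A ν).topologicalClosure ⟂ (eigenspace A μ).topologicalClosure :=
    Submodule.topologicalClosure_minimal _ h1.symm (Submodule.isClosed_orthogonal _)
  exact h2.symm

theorem eigenProj_apply_of_mem {μ : ℝ} {x : X} (hx : x ∈ eigenspace A μ) :
    eigenProj A μ x = x :=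
  Submodule.starProjection_eq_self_iff.2 (Submodule.le_topologicalClosure _ hx)

theorem eigenspace_ne_bot_of_eigenProj_ne_zero {μ : ℝ} (h : eigenProj A μ ≠ 0) :
    eigenspace A μ ≠ ⊥ := by
  intro h0
  refine h (ContinuousLinearMap.ext fun x => ?_)
  have hx := Submodule.starProjection_apply_mem (eigenspace A μ).topologicalClosure x
  have hcl : (eigenspace A μ).topologicalClosure ≤ ⊥ := by
    rw [h0]
    exact Submodule.topologicalClosure_minimal _ le_rfl isClosed_singleton
  exact (Submodule.mem_bot ℝ).1 (hcl hx)

theorem IsNonnegSelfAdjointCompactResolvent.nonneg_of_eigenProj_ne_zero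
    (hA : IsNonnegSelfAdjointCompactResolvent A) {μ : ℝ} (h : eigenProj A μ ≠ 0) : 0 ≤ μ := by
  obtain ⟨x, ⟨hx, ex⟩, hx0⟩ :=
    Submodule.exists_mem_ne_zero_of_ne_bot (eigenspace_ne_bot_of_eigenProj_ne_zero h)
  have h1 := hA.nonneg ⟨x, hx⟩
  rw [ex, inner_smul_left, real_inner_self_eq_norm_sq] at h1
  exact nonneg_of_mul_nonneg_left (by simpa using h1) (by positivity)

/-- The spectral theorem applied to the compact symmetric resolvent R. An eigenvector of R for r ≠ 0
is an eigenvector of A for r⁻¹ − c, and r = 0 contributes nothing because R is injective. -/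
theorem IsNonnegSelfAdjointCompactResolvent.eq_zero_of_eigenProj_eq_zero
    (hA : IsNonnegSelfAdjointCompactResolvent A) {x : X} (hx : ∀ μ, eigenProj A μ x = 0) :
    x = 0 := by
  obtain ⟨c, hc, R, hR, hR1, hR2⟩ := hA.compactResolvent
  have hsymm : (R : X →ₗ[ℝ] X).IsSymmetric := by
    intro y z
    obtain ⟨hy, ey⟩ := hR1 y
    obtain ⟨hz, ez⟩ := hR1 z
    have h := hA.inner_comm ⟨R y, hy⟩ ⟨R z, hz⟩
    change inner ℝ (R y) z = inner ℝ y (R z)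
    nth_rw 1 [← ez]
    nth_rw 2 [← ey]
    rw [inner_add_right, inner_add_left, inner_smul_left, inner_smul_right, ← h]
    simp
  have hbot := ContinuousLinearMap.orthogonalComplement_iSup_eigenspaces_eq_bot hR hsymm
  have hmem : x ∈ (⨆ r, Module.End.eigenspace (R : X →ₗ[ℝ] X) r)ᗮ := by
    rw [← Submodule.iInf_orthogonal, Submodule.mem_iInf]
    intro r y hy
    have hy' : R y = r • y := Module.End.mem_eigenspace_iff.1 hy
    obtain ⟨hd, e⟩ := hR1 y
    by_cases hr : r = 0
    · subst hr
      rw [zero_smul] at hy'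
      have h0 : A ⟨R y, hd⟩ = 0 := by
        have : (⟨R y, hd⟩ : A.domain) = 0 := Subtype.ext hy'
        rw [this, LinearPMap.map_zero]
      rw [h0, hy', smul_zero, zero_add] at e
      rw [← e, inner_zero_left]
    · have hyd : y ∈ A.domain := by
        have := A.domain.smul_mem r⁻¹ hd
        rwa [hy', smul_smul, inv_mul_cancel₀ hr, one_smul] at this
      have hye : y ∈ eigenspace A (r⁻¹ - c) := by
        refine ⟨hyd, ?_⟩
        have h1 : (⟨R y, hd⟩ : A.domain) = r • ⟨y, hyd⟩ := Subtype.ext hy'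
        rw [h1, hy', LinearPMap.map_smul, smul_comm, ← smul_add] at e
        have h2 : c • y + A ⟨y, hyd⟩ = r⁻¹ • y := by
          rw [eq_inv_smul_iff₀ hr, e]
        rw [sub_smul, ← h2, add_sub_cancel_left]
      have h3 : x ∈ (eigenspace A (r⁻¹ - c)).topologicalClosureᗮ :=
        (Submodule.starProjection_apply_eq_zero_iff _).1 (hx _)
      exact h3 y (Submodule.le_topologicalClosure _ hye)
  rw [hbot] at hmem
  exact (Submodule.mem_bot ℝ).1 hmem

theorem IsNonnegSelfAdjointCompactResolvent.spectralFamily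
    (hA : IsNonnegSelfAdjointCompactResolvent A) : SpectralFamily (eigenProj A) where
  idem _ x := Submodule.starProjection_eq_self_iff.2 (Submodule.starProjection_apply_mem _ x)
  orth _ _ x h := (Submodule.starProjection_apply_eq_zero_iff _).2 <|
    (hA.isOrtho_closure h).symm (Submodule.starProjection_apply_mem _ x)
  symm _ x y := Submodule.inner_starProjection_left_eq_right _ x y
  total _ := hA.eq_zero_of_eigenProj_eq_zero

end Eigenspaces

end

/-! ### The mode kernel and smoothing by Duhamel integrals. -/

section

variable {X : Type*} [NormedAddCommGroup X] [InnerProductSpace ℝ X]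

theorem norm_integral_smul_sq_le {α : Type*} [MeasurableSpace α] {m : Measure α} {k : α → ℝ}
    {f : α → X} (hk : MemLp k 2 m) (hf : MemLp f 2 m) :
    ‖∫ s, k s • f s ∂m‖ ^ 2 ≤ (∫ s, k s ^ 2 ∂m) * ∫ s, ‖f s‖ ^ 2 ∂m := by
  have h2 : (2 : ℝ).HolderConjugate 2 := Real.HolderConjugate.two_two
  have hk' : MemLp (fun s => |k s|) (ENNReal.ofReal 2) m := by
    rw [ENNReal.ofReal_ofNat]; exact hk.abs
  have hf' : MemLp (fun s => ‖f s‖) (ENNReal.ofReal 2) m := by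
    rw [ENNReal.ofReal_ofNat]; exact hf.norm
  have h := integral_mul_le_Lp_mul_Lq_of_nonneg h2 (.of_forall fun s => abs_nonneg (k s))
    (.of_forall fun s => norm_nonneg (f s)) hk' hf'
  have h0 : ‖∫ s, k s • f s ∂m‖ ≤ ∫ s, |k s| * ‖f s‖ ∂m :=
    (norm_integral_le_integral_norm _).trans_eq (by simp [norm_smul])
  have hle := h0.trans h
  simp only [Real.rpow_two, sq_abs, ← Real.sqrt_eq_rpow] at hle
  refine (pow_le_pow_left₀ (norm_nonneg _) hle 2).trans_eq ?_
  rw [mul_pow, Real.sq_sqrt (by positivity), Real.sq_sqrt (by positivity)]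

/-- The scalar kernel `(1 + μ)^{1/2} e^{-(μ - lam) r}` of a single mode. -/
noncomputable def modeKernel (lam μ r : ℝ) : ℝ := Real.sqrt (1 + μ) * Real.exp (-((μ - lam) * r))

theorem continuous_modeKernel (lam μ : ℝ) : Continuous (modeKernel lam μ) := by
  unfold modeKernel; fun_prop

/-- Split 1 + μ = (1 + lam) + (μ − lam). The first part contributes at most (1 + lam)(t − a). The
second is an exact derivative whose integral is at most 1/2, however large μ is. -/
theorem integral_modeKernel_sq_le {lam μ a t : ℝ} (hlam : 0 ≤ lam) (hμ : lam ≤ μ) (hat : a ≤ t) :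
    ∫ s in a..t, modeKernel lam μ (t - s) ^ 2 ≤ (1 + lam) * (t - a) + 1 / 2 := by
  set δ := μ - lam with hδ
  have hδ0 : 0 ≤ δ := sub_nonneg.2 hμ
  have hsq : ∀ s, modeKernel lam μ (t - s) ^ 2 =
      (1 + lam) * Real.exp (-(2 * δ * (t - s))) + δ * Real.exp (-(2 * δ * (t - s))) := by
    intro s
    rw [modeKernel, mul_pow, Real.sq_sqrt (by linarith), ← Real.exp_nat_mul, ← add_mul]
    congr 1
    · rw [hδ]; ring
    · congr 1; push_cast; ring
  have hd : ∀ s, HasDerivAt (fun s => Real.exp (-(2 * δ * (t - s))) / 2)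
      (δ * Real.exp (-(2 * δ * (t - s)))) s := by
    intro s
    have h1 : HasDerivAt (fun s => -(2 * δ * (t - s))) (2 * δ) s := by
      refine HasDerivAt.congr_deriv (f' := -(2 * δ * -1)) ?_ (by ring)
      exact (((hasDerivAt_id s).const_sub t).const_mul (2 * δ)).neg
    exact (h1.exp.div_const 2).congr_deriv (by ring)
  have hc : Continuous fun s => Real.exp (-(2 * δ * (t - s))) := by fun_prop
  simp_rw [hsq]
  rw [intervalIntegral.integral_add ((hc.const_mul _).intervalIntegrable _ _)
    ((hc.const_mul _).intervalIntegrable _ _),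
    intervalIntegral.integral_eq_sub_of_hasDerivAt (fun s _ => hd s)
      ((hc.const_mul _).intervalIntegrable _ _)]
  have h1 : ∫ s in a..t, (1 + lam) * Real.exp (-(2 * δ * (t - s))) ≤ ∫ _s in a..t, (1 + lam) := by
    refine intervalIntegral.integral_mono_on hat ((hc.const_mul _).intervalIntegrable _ _)
      intervalIntegrable_const fun s hs => ?_
    refine mul_le_of_le_one_right (by linarith) (Real.exp_le_one_iff.2 ?_)
    have : 0 ≤ 2 * δ * (t - s) := mul_nonneg (by linarith) (by linarith [hs.2])
    linarith
  rw [intervalIntegral.integral_const, smul_eq_mul] at h1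
  have h2 : 0 < Real.exp (-(2 * δ * (t - a))) := Real.exp_pos _
  simp only [sub_self, mul_zero, neg_zero, Real.exp_zero]
  linarith

theorem norm_integral_modeKernel_sq_le {lam μ a t : ℝ} (hlam : 0 ≤ lam) (hμ : lam ≤ μ)
    (hat : a ≤ t) {g : ℝ → X} (hg : MemLp g 2 (volume.restrict (Ioc a t))) :
    ‖∫ s in a..t, modeKernel lam μ (t - s) • g s‖ ^ 2 ≤
      ((1 + lam) * (t - a) + 1 / 2) * ∫ s in a..t, ‖g s‖ ^ 2 := by
  have hk : MemLp (fun s => modeKernel lam μ (t - s)) 2 (volume.restrict (Ioc a t)) := by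
    have hc : Continuous fun s => modeKernel lam μ (t - s) :=
      (continuous_modeKernel lam μ).comp (continuous_const.sub continuous_id)
    refine (memLp_two_iff_integrable_sq hc.aestronglyMeasurable).2 ?_
    exact ((hc.pow 2).integrableOn_Icc).mono_set Ioc_subset_Icc_self
  have h := norm_integral_smul_sq_le hk hg
  rw [← intervalIntegral.integral_of_le hat, ← intervalIntegral.integral_of_le hat,
    ← intervalIntegral.integral_of_le hat] at h
  exact h.trans (mul_le_mul_of_nonneg_right (integral_modeKernel_sq_le hlam hμ hat)
    (intervalIntegral.integral_nonneg hat fun s _ => by positivity))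

/-- The factor depending on t comes out of the exponential, leaving a primitive of an integrable
function. -/
theorem continuousOn_integral_modeKernel {μ T : ℝ} (hT : 0 ≤ T) {g : ℝ → X}
    (hg : IntegrableOn g (Ioc 0 T)) :
    ContinuousOn (fun t => ∫ s in (0 : ℝ)..t, modeKernel 0 μ (t - s) • g s) (Icc 0 T) := by
  have heq : ∀ t, ∫ s in (0 : ℝ)..t, modeKernel 0 μ (t - s) • g s =
      (Real.sqrt (1 + μ) * Real.exp (-(μ * t))) • ∫ s in (0 : ℝ)..t, Real.exp (μ * s) • g s := by
    intro t
    rw [← intervalIntegral.integral_smul]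
    refine intervalIntegral.integral_congr fun s _ => ?_
    simp only [modeKernel, smul_smul, mul_assoc, ← Real.exp_add]
    ring_nf
  simp_rw [heq]
  refine ContinuousOn.smul (by fun_prop) ?_
  have hint : IntervalIntegrable (fun s => Real.exp (μ * s) • g s) volume 0 T :=
    ((intervalIntegrable_iff_integrableOn_Ioc_of_le hT).2 hg).continuousOn_smul
      (by fun_prop)
  have := intervalIntegral.continuousOn_primitive_interval' hint left_mem_uIcc
  rwa [uIcc_of_le hT] at this

namespace SpectralFamily

variable {P : ℝ → X →L[ℝ] X}

theorem sum_integral_norm_sq_le (hP : SpectralFamily P) {a t : ℝ} (hat : a ≤ t) {f : ℝ → X}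
    (hf : MemLp f 2 (volume.restrict (Ioc a t))) (s : Finset ℝ) :
    ∑ μ ∈ s, ∫ r in a..t, ‖P μ (f r)‖ ^ 2 ≤ ∫ r in a..t, ‖f r‖ ^ 2 := by
  simp only [intervalIntegral.integral_of_le hat]
  have hint : ∀ μ, Integrable (fun r => ‖P μ (f r)‖ ^ 2) (volume.restrict (Ioc a t)) :=
    fun μ => ((P μ).comp_memLp' hf).integrable_norm_pow two_ne_zero
  rw [← integral_finsetSum _ fun μ _ => hint μ]
  exact integral_mono (integrable_finsetSum _ fun μ _ => hint μ)
    (hf.integrable_norm_pow two_ne_zero) fun r => hP.sum_norm_sq_le (f r) s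

variable [CompleteSpace X]

/-- The smoothing estimate: the components of `x` are those of `(1 + A)^{1/2}` applied to a
Duhamel integral. -/
theorem norm_sq_le_of_modes (hP : SpectralFamily P) {lam : ℝ} (hlam : 0 ≤ lam)
    (hlow : ∀ μ, P μ ≠ 0 → lam ≤ μ) {a t : ℝ} (hat : a ≤ t) {f : ℝ → X}
    (hf : MemLp f 2 (volume.restrict (Ioc a t))) {x : X}
    (hx : ∀ μ, P μ x = ∫ s in a..t, modeKernel lam μ (t - s) • P μ (f s)) :
    ‖x‖ ^ 2 ≤ ((1 + lam) * (t - a) + 1 / 2) * ∫ s in a..t, ‖f s‖ ^ 2 := by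
  have hK : 0 ≤ (1 + lam) * (t - a) + 1 / 2 := by
    have := mul_nonneg (by linarith : 0 ≤ 1 + lam) (sub_nonneg.2 hat)
    linarith
  refine hP.norm_sq_le_of_sum_le fun F => ?_
  refine le_trans ?_ (mul_le_mul_of_nonneg_left (hP.sum_integral_norm_sq_le hat hf F) hK)
  rw [Finset.mul_sum]
  refine Finset.sum_le_sum fun μ _ => ?_
  by_cases h : P μ = 0
  · simp [h]
  · rw [hx]
    exact norm_integral_modeKernel_sq_le hlam (hlow μ h) hat ((P μ).comp_memLp' hf)

/-- The vector is recovered from its prescribed components, so (1 + A)^{1/2} e^{-(t-s)A} never has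
to be integrated as an operator-valued kernel. The dominating family is independent of t, which also
yields continuity. -/
theorem exists_duhamel (hP : SpectralFamily P) (hlow : ∀ μ, P μ ≠ 0 → 0 ≤ μ) {T : ℝ}
    (hT : 0 ≤ T) {f : ℝ → X} (hf : MemLp f 2 (volume.restrict (Ioc 0 T))) :
    ∃ w : ℝ → X, ContinuousOn w (Icc 0 T) ∧ ∀ t ∈ Icc 0 T, ∀ μ,
      P μ (w t) = ∫ s in (0 : ℝ)..t, modeKernel 0 μ (t - s) • P μ (f s) := by
  have hfi : ∀ μ, IntegrableOn (fun s => P μ (f s)) (Ioc 0 T) := fun μ =>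
    ((P μ).comp_memLp' hf).integrable one_le_two
  have hsub : ∀ t ∈ Icc 0 T, Ioc 0 t ⊆ Ioc 0 T := fun t ht => Ioc_subset_Ioc_right ht.2
  set b : ℝ → ℝ := fun μ => (T + 1 / 2) * ∫ s in (0 : ℝ)..T, ‖P μ (f s)‖ ^ 2 with hb
  have hbs : Summable b := by
    refine Summable.mul_left _ (summable_of_sum_le (fun μ => ?_) (hP.sum_integral_norm_sq_le hT hf))
    exact intervalIntegral.integral_nonneg hT fun s _ => by positivity
  have hbound : ∀ t ∈ Icc 0 T, ∀ μ,
      ‖∫ s in (0 : ℝ)..t, modeKernel 0 μ (t - s) • P μ (f s)‖ ^ 2 ≤ b μ := by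
    intro t ht μ
    have hb0 : 0 ≤ ∫ s in (0 : ℝ)..T, ‖P μ (f s)‖ ^ 2 :=
      intervalIntegral.integral_nonneg hT fun s _ => by positivity
    by_cases h : P μ = 0
    · simp only [h, _root_.zero_apply, smul_zero, intervalIntegral.integral_zero,
        norm_zero, hb]
      simp
    · have h1 := norm_integral_modeKernel_sq_le le_rfl (hlow μ h) ht.1
        (((P μ).comp_memLp' hf).mono_measure (Measure.restrict_mono (hsub t ht) le_rfl))
      refine h1.trans (mul_le_mul (by linarith [ht.2]) ?_ ?_ (by linarith))
      · refine intervalIntegral.integral_mono_interval le_rfl ht.1 ht.2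
          (.of_forall fun s => by positivity) ?_
        exact (intervalIntegrable_iff_integrableOn_Ioc_of_le hT).2
          (((P μ).comp_memLp' hf).integrable_norm_pow two_ne_zero)
      · exact intervalIntegral.integral_nonneg ht.1 fun s _ => by positivity
  have hidem : ∀ t ∈ Icc 0 T, ∀ μ,
      P μ (∫ s in (0 : ℝ)..t, modeKernel 0 μ (t - s) • P μ (f s)) =
        ∫ s in (0 : ℝ)..t, modeKernel 0 μ (t - s) • P μ (f s) := by
    intro t ht μ
    rw [← (P μ).intervalIntegral_comp_comm]
    · simp only [map_smul, hP.idem]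
    · refine ((intervalIntegrable_iff_integrableOn_Ioc_of_le ht.1).2
        ((hfi μ).mono_set (hsub t ht))).continuousOn_smul ?_
      exact ((continuous_modeKernel 0 μ).comp (continuous_const.sub continuous_id)).continuousOn
  have hex : ∀ t, ∃ x, t ∈ Icc 0 T → ∀ μ,
      P μ x = ∫ s in (0 : ℝ)..t, modeKernel 0 μ (t - s) • P μ (f s) := by
    intro t
    by_cases ht : t ∈ Icc 0 T
    · obtain ⟨x, hx⟩ := hP.exists_of_summable (hidem t ht)
        (hbs.of_nonneg_of_le (fun _ => by positivity) (hbound t ht))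
      exact ⟨x, fun _ => hx⟩
    · exact ⟨0, fun h => absurd h ht⟩
  choose w hw using hex
  refine ⟨w, hP.continuousOn hbs (fun μ => ?_) (fun μ t ht => ?_), hw⟩
  · exact (continuousOn_integral_modeKernel hT (hfi μ)).congr fun t ht => hw t ht μ
  · rw [hw t ht]
    exact hbound t ht μ

/-- Existence of the semigroup orbit `e^{-tA} x`. -/
theorem exists_orbit (hP : SpectralFamily P) (hlow : ∀ μ, P μ ≠ 0 → 0 ≤ μ) (x : X) :
    ∃ y : ℝ → X, ContinuousOn y (Ici 0) ∧
      ∀ t ∈ Ici (0 : ℝ), ∀ μ, P μ (y t) = Real.exp (-(μ * t)) • P μ x := by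
  have hex : ∀ t, ∃ y, t ∈ Ici (0 : ℝ) → ∀ μ, P μ y = Real.exp (-(μ * t)) • P μ x := by
    intro t
    by_cases ht : t ∈ Ici (0 : ℝ)
    · obtain ⟨M, hM, -⟩ := hP.exists_multiplier (f := fun μ => Real.exp (-(μ * t))) fun μ hμ => by
        rw [abs_of_pos (Real.exp_pos _), Real.exp_le_one_iff]
        have := mul_nonneg (hlow μ hμ) ht
        linarith
      exact ⟨M x, fun _ μ => hM μ x⟩
    · exact ⟨0, fun h => absurd h ht⟩
  choose y hy using hex
  refine ⟨y, hP.continuousOn (hP.summable_norm_sq x) (fun μ => ?_) (fun μ t ht => ?_), hy⟩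
  · have hc : ContinuousOn (fun t => Real.exp (-(μ * t)) • P μ x) (Ici 0) := by fun_prop
    exact hc.congr fun t ht => hy t ht μ
  · rw [hy t ht]
    by_cases h : P μ = 0
    · simp [h]
    · refine pow_le_pow_left₀ (norm_nonneg _) ?_ 2
      rw [norm_smul, Real.norm_eq_abs, abs_of_pos (Real.exp_pos _)]
      refine mul_le_of_le_one_left (norm_nonneg _) (Real.exp_le_one_iff.2 ?_)
      have := mul_nonneg (hlow μ h) ht
      linarith

end SpectralFamily

end

/-! ### Well-posedness of the modal equation for controls in L². -/

section

theorem lipschitzOnWith_comp_absolutelyContinuousOnInterval {F f : ℝ → ℝ} {K : NNReal}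
    {s : Set ℝ} {a b : ℝ} (hF : LipschitzOnWith K F s) (hf : AbsolutelyContinuousOnInterval f a b)
    (hs : MapsTo f (uIcc a b) s) : AbsolutelyContinuousOnInterval (fun x => F (f x)) a b := by
  rw [absolutelyContinuousOnInterval_iff] at hf ⊢
  intro ε hε
  obtain ⟨δ, hδ, h⟩ := hf (ε / (K + 1)) (by positivity)
  refine ⟨δ, hδ, fun E hE hlt => ?_⟩
  have h1 := h E hE hlt
  rw [lt_div_iff₀ (by positivity)] at h1
  refine lt_of_le_of_lt ?_ h1
  rw [Finset.sum_mul]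
  refine Finset.sum_le_sum fun i hi => ?_
  have hmem := hE.1 i hi
  refine (hF.dist_le_mul _ (hs hmem.1) _ (hs hmem.2)).trans ?_
  rw [mul_comm]
  exact mul_le_mul_of_nonneg_left (by linarith) dist_nonneg

/-- The exponential weight absorbing the control `g = p ^ 2`. -/
theorem integral_mul_exp_le {g : ℝ → ℝ} {t κ : ℝ} (ht : 0 ≤ t) (hκ : 0 < κ)
    (hg : IntervalIntegrable g volume 0 t) (hg0 : ∀ s, 0 ≤ g s) :
    ∫ s in (0 : ℝ)..t,
      g s * Real.exp (κ * ((∫ r in (0 : ℝ)..s, g r) - ∫ r in (0 : ℝ)..t, g r)) ≤ 1 / κ := by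
  set G : ℝ → ℝ := fun s => ∫ r in (0 : ℝ)..s, g r with hG
  change ∫ s in (0 : ℝ)..t, g s * Real.exp (κ * (G s - G t)) ≤ 1 / κ
  have hGac : AbsolutelyContinuousOnInterval G 0 t :=
    hg.absolutelyContinuousOnInterval_intervalIntegral left_mem_uIcc
  have hGle : ∀ s ∈ uIcc 0 t, G s ≤ G t := by
    intro s hs
    rw [uIcc_of_le ht] at hs
    exact intervalIntegral.integral_mono_interval le_rfl hs.1 hs.2 (.of_forall hg0) hg
  -- G is only absolutely continuous, since g is merely integrable. To the left of G t the weight is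
  -- at most 1, so its slope is at most κ, and the composition stays absolutely continuous.
  have hlip : LipschitzOnWith κ.toNNReal (fun x => Real.exp (κ * (x - G t))) (Iic (G t)) := by
    refine Convex.lipschitzOnWith_of_nnnorm_hasDerivWithin_le
      (f' := fun x => Real.exp (κ * (x - G t)) * κ) (convex_Iic _) (fun x _ => ?_) fun x hx => ?_
    · have : HasDerivAt (fun x => κ * (x - G t)) κ x := by
        simpa using ((hasDerivAt_id x).sub_const (G t)).const_mul κ
      exact this.exp.hasDerivWithinAt
    · rw [← NNReal.coe_le_coe, coe_nnnorm, Real.coe_toNNReal _ hκ.le, Real.norm_of_nonneg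
        (by positivity)]
      refine mul_le_of_le_one_left hκ.le (Real.exp_le_one_iff.2 ?_)
      exact mul_nonpos_of_nonneg_of_nonpos hκ.le (sub_nonpos.2 hx)
  have hac : AbsolutelyContinuousOnInterval (fun s => Real.exp (κ * (G s - G t))) 0 t :=
    lipschitzOnWith_comp_absolutelyContinuousOnInterval
      (F := fun x => Real.exp (κ * (x - G t))) hlip hGac hGle
  have hint := hac.integral_deriv_eq_sub
  have hderiv : ∫ s in (0 : ℝ)..t, deriv (fun s => Real.exp (κ * (G s - G t))) s =
      ∫ s in (0 : ℝ)..t, κ * (g s * Real.exp (κ * (G s - G t))) := by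
    refine intervalIntegral.integral_congr_ae ?_
    filter_upwards [hg.ae_hasDerivAt_integral] with s hs hst
    have h1 : HasDerivAt G (g s) s := hs (uIoc_subset_uIcc hst) 0 left_mem_uIcc
    have h2 := ((h1.sub_const (G t)).const_mul κ).exp.deriv
    rw [h2]; ring
  rw [hderiv, intervalIntegral.integral_const_mul, sub_self, mul_zero, Real.exp_zero] at hint
  rw [le_div_iff₀ hκ, mul_comm, hint]
  linarith [Real.exp_pos (κ * (G 0 - G t))]

variable {X : Type*} [NormedAddCommGroup X] [InnerProductSpace ℝ X]

theorem memLp_smul_of_continuousOn {p : ℝ → ℝ} {h : ℝ → X} {a b : ℝ}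
    (hp : MemLp p 2 (volume.restrict (Ioc a b))) (hh : ContinuousOn h (Icc a b)) :
    MemLp (fun s => p s • h s) 2 (volume.restrict (Ioc a b)) := by
  obtain ⟨M, hM⟩ := isCompact_Icc.exists_bound_of_continuousOn hh
  have hmeas : AEStronglyMeasurable h (volume.restrict (Ioc a b)) :=
    (hh.aestronglyMeasurable_of_isCompact isCompact_Icc measurableSet_Icc).mono_measure
      (Measure.restrict_mono Ioc_subset_Icc_self le_rfl)
  refine hp.of_le_mul (c := M) (hp.1.smul hmeas) ?_
  filter_upwards [ae_restrict_mem measurableSet_Ioc] with s hs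
  rw [norm_smul, mul_comm]
  exact mul_le_mul_of_nonneg_right (hM s (Ioc_subset_Icc_self hs)) (norm_nonneg _)

/-- `z` solves, mode by mode, the integral equation for `z = (1 + A)^{1/2} u`, where
`C = B (1 + A)^{-1/2}`. -/
structure IsModalSolution (P : ℝ → X →L[ℝ] X) (C : X →L[ℝ] X) (p : ℝ → ℝ) (T : ℝ) (z₀ : X)
    (z : ℝ → X) : Prop where
  cont : ContinuousOn z (Icc 0 T)
  eq : ∀ t ∈ Icc 0 T, ∀ μ, P μ (z t) = Real.exp (-(μ * t)) • P μ z₀ -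
    ∫ s in (0 : ℝ)..t, modeKernel 0 μ (t - s) • P μ (p s • C (z s))

theorem IsModalSolution.mono {P : ℝ → X →L[ℝ] X} {C : X →L[ℝ] X} {p : ℝ → ℝ} {T T' : ℝ}
    {z₀ : X} {z : ℝ → X} (h : IsModalSolution P C p T z₀ z) (hT : T' ≤ T) :
    IsModalSolution P C p T' z₀ z :=
  ⟨h.cont.mono (Icc_subset_Icc_right hT), fun t ht => h.eq t ⟨ht.1, ht.2.trans hT⟩⟩

theorem IsModalSolution.congr_control {P : ℝ → X →L[ℝ] X} {C : X →L[ℝ] X} {p q : ℝ → ℝ} {T : ℝ}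
    {z₀ : X} {z : ℝ → X} (h : IsModalSolution P C p T z₀ z)
    (hpq : p =ᵐ[volume.restrict (Ioc 0 T)] q) : IsModalSolution P C q T z₀ z := by
  refine ⟨h.cont, fun t ht μ => (h.eq t ht μ).trans ?_⟩
  congr 1
  refine intervalIntegral.integral_congr_ae ?_
  filter_upwards [(ae_restrict_iff' measurableSet_Ioc).1 hpq] with s hs hst
  rw [uIoc_of_le ht.1] at hst
  rw [hs ⟨hst.1, hst.2.trans ht.2⟩]

theorem intervalIntegrable_modeKernel_smul {P : ℝ → X →L[ℝ] X} {lam μ a t r : ℝ} (hat : a ≤ t)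
    {f : ℝ → X} (hf : IntegrableOn f (Ioc a t)) :
    IntervalIntegrable (fun s => modeKernel lam μ (r - s) • P μ (f s)) volume a t := by
  refine ((intervalIntegrable_iff_integrableOn_Ioc_of_le hat).2
    ((P μ).integrable_comp hf)).continuousOn_smul ?_
  exact ((continuous_modeKernel lam μ).comp (continuous_const.sub continuous_id)).continuousOn

section Wellposed

variable [CompleteSpace X] {P : ℝ → X →L[ℝ] X} {C : X →L[ℝ] X} {p : ℝ → ℝ} {T : ℝ}

/-- Insert the weighted bound on d into the smoothing estimate. The weight turns ∫ p² exp(2κ ∫ p²)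
into at most exp(2κ ∫₀ᵗ p²)/(2κ), and the choice of κ makes the total factor at most 1/4 on squares.
-/
theorem SpectralFamily.weighted_contraction (hP : SpectralFamily P)
    (hlow : ∀ μ, P μ ≠ 0 → 0 ≤ μ) (hp : MemLp p 2 (volume.restrict (Ioc 0 T)))
    {κ : ℝ} (hκ : 2 * (T + 1 / 2) * ‖C‖ ^ 2 ≤ κ) (hκ0 : 0 < κ) {d : ℝ → X} {M : ℝ}
    (hd : ContinuousOn d (Icc 0 T))
    (hM : ∀ s ∈ Icc 0 T, ‖d s‖ ≤ Real.exp (κ * ∫ r in (0 : ℝ)..s, p r ^ 2) * M)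
    {t : ℝ} (ht : t ∈ Icc 0 T) {x : X}
    (hx : ∀ μ, P μ x = ∫ s in (0 : ℝ)..t, modeKernel 0 μ (t - s) • P μ (p s • C (d s))) :
    ‖x‖ ≤ Real.exp (κ * ∫ r in (0 : ℝ)..t, p r ^ 2) * (M / 2) := by
  have hM0 : 0 ≤ M := by
    have := (norm_nonneg _).trans (hM t ht)
    exact nonneg_of_mul_nonneg_right this (Real.exp_pos _)
  have hpt : MemLp p 2 (volume.restrict (Ioc 0 t)) :=
    hp.mono_measure (Measure.restrict_mono (Ioc_subset_Ioc_right ht.2) le_rfl)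
  have hdt : ContinuousOn d (Icc 0 t) := hd.mono (Icc_subset_Icc_right ht.2)
  have hmem : MemLp (fun s => p s • C (d s)) 2 (volume.restrict (Ioc 0 t)) :=
    memLp_smul_of_continuousOn hpt (C.continuous.comp_continuousOn hdt)
  have h1 := hP.norm_sq_le_of_modes le_rfl hlow ht.1 hmem hx
  have hpi : IntervalIntegrable (fun s => p s ^ 2) volume 0 t :=
    (intervalIntegrable_iff_integrableOn_Ioc_of_le ht.1).2 hpt.integrable_sq
  set G : ℝ → ℝ := fun s => ∫ r in (0 : ℝ)..s, p r ^ 2 with hG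
  have hGc : ContinuousOn G (uIcc 0 t) :=
    intervalIntegral.continuousOn_primitive_interval' hpi left_mem_uIcc
  have h2 : ∫ s in (0 : ℝ)..t, ‖p s • C (d s)‖ ^ 2 ≤
      ∫ s in (0 : ℝ)..t, (‖C‖ ^ 2 * M ^ 2 * Real.exp (2 * κ * G t)) *
        (p s ^ 2 * Real.exp (2 * κ * (G s - G t))) := by
    refine intervalIntegral.integral_mono_on ht.1 ?_ ?_ fun s hs => ?_
    · exact (intervalIntegrable_iff_integrableOn_Ioc_of_le ht.1).2
        (hmem.integrable_norm_pow two_ne_zero)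
    · refine (hpi.mul_continuousOn ?_).const_mul _
      exact Real.continuous_exp.comp_continuousOn ((hGc.sub continuousOn_const).const_mul _)
    · have h3 : ‖C (d s)‖ ≤ ‖C‖ * (Real.exp (κ * G s) * M) :=
        (C.le_opNorm _).trans (mul_le_mul_of_nonneg_left
          (hM s ⟨hs.1, hs.2.trans ht.2⟩) (norm_nonneg _))
      rw [norm_smul, mul_pow, Real.norm_eq_abs, sq_abs]
      have h4 := pow_le_pow_left₀ (norm_nonneg _) h3 2
      have h5 : Real.exp (2 * κ * G t) * Real.exp (2 * κ * (G s - G t)) =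
          Real.exp (κ * G s) ^ 2 := by
        rw [← Real.exp_add, ← Real.exp_nat_mul]
        congr 1; push_cast; ring
      calc p s ^ 2 * ‖C (d s)‖ ^ 2 ≤ p s ^ 2 * (‖C‖ * (Real.exp (κ * G s) * M)) ^ 2 :=
            mul_le_mul_of_nonneg_left h4 (sq_nonneg _)
        _ = _ := by rw [mul_pow, mul_pow, ← h5]; ring
  rw [intervalIntegral.integral_const_mul] at h2
  have h3 := integral_mul_exp_le ht.1 (κ := 2 * κ) (by positivity) hpi fun s => sq_nonneg _
  change ∫ s in (0 : ℝ)..t, p s ^ 2 * Real.exp (2 * κ * (G s - G t)) ≤ 1 / (2 * κ) at h3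
  refine le_of_sq_le_sq ?_ (by positivity)
  have hexp : Real.exp (2 * κ * G t) = Real.exp (κ * G t) ^ 2 := by
    rw [← Real.exp_nat_mul]; congr 1; push_cast; ring
  have hT0 : 0 ≤ t := ht.1
  calc ‖x‖ ^ 2 ≤ ((1 + 0) * (t - 0) + 1 / 2) *
        ((‖C‖ ^ 2 * M ^ 2 * Real.exp (2 * κ * G t)) * (1 / (2 * κ))) :=
        h1.trans (mul_le_mul_of_nonneg_left
          (h2.trans (mul_le_mul_of_nonneg_left h3 (by positivity))) (by linarith))
    _ ≤ (T + 1 / 2) * ((‖C‖ ^ 2 * M ^ 2 * Real.exp (2 * κ * G t)) * (1 / (2 * κ))) :=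
        mul_le_mul_of_nonneg_right (by linarith [ht.2]) (by positivity)
    _ = (2 * (T + 1 / 2) * ‖C‖ ^ 2) * (M ^ 2 * Real.exp (2 * κ * G t)) / (4 * κ) := by
        field_simp; ring
    _ ≤ κ * (M ^ 2 * Real.exp (2 * κ * G t)) / (4 * κ) := by
        gcongr
    _ = (Real.exp (κ * G t) * (M / 2)) ^ 2 := by
        rw [hexp]; field_simp; ring

theorem IsModalSolution.unique (hP : SpectralFamily P) (hlow : ∀ μ, P μ ≠ 0 → 0 ≤ μ)
    (hp : MemLp p 2 (volume.restrict (Ioc 0 T))) {z₀ : X} {z z' : ℝ → X}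
    (hz : IsModalSolution P C p T z₀ z) (hz' : IsModalSolution P C p T z₀ z') :
    ∀ t ∈ Icc 0 T, z t = z' t := by
  intro t ht
  have hT : 0 ≤ T := ht.1.trans ht.2
  set κ := 2 * (T + 1 / 2) * ‖C‖ ^ 2 + 1 with hκ
  have hκ0 : 0 < κ := by positivity
  set d : ℝ → X := fun s => z s - z' s with hd
  have hdc : ContinuousOn d (Icc 0 T) := hz.cont.sub hz'.cont
  have hmodes : ∀ t ∈ Icc 0 T, ∀ μ,
      P μ (-d t) = ∫ s in (0 : ℝ)..t, modeKernel 0 μ (t - s) • P μ (p s • C (d s)) := by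
    intro t ht μ
    have hpt : MemLp p 2 (volume.restrict (Ioc 0 t)) :=
      hp.mono_measure (Measure.restrict_mono (Ioc_subset_Ioc_right ht.2) le_rfl)
    have hint : ∀ y : ℝ → X, ContinuousOn y (Icc 0 T) → IntervalIntegrable
        (fun s => modeKernel 0 μ (t - s) • P μ (p s • C (y s))) volume 0 t := fun y hy =>
      intervalIntegrable_modeKernel_smul ht.1 ((memLp_smul_of_continuousOn hpt
        (C.continuous.comp_continuousOn
          (hy.mono (Icc_subset_Icc_right ht.2)))).integrable one_le_two)
    simp only [hd, map_sub, smul_sub, map_neg]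
    rw [intervalIntegral.integral_sub (hint z hz.cont) (hint z' hz'.cont), hz.eq t ht,
      hz'.eq t ht]
    abel
  obtain ⟨M, hM⟩ := isCompact_Icc.exists_bound_of_continuousOn hdc
  -- The difference solves the homogeneous equation, so each bound on it implies the same bound
  -- halved.
  have hiter : ∀ n : ℕ, ∀ t ∈ Icc 0 T,
      ‖d t‖ ≤ Real.exp (κ * ∫ r in (0 : ℝ)..t, p r ^ 2) * (M / 2 ^ n) := by
    intro n
    induction n with
    | zero =>
      intro t ht
      rw [pow_zero, div_one]
      have hM0 := (norm_nonneg _).trans (hM t ht)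
      refine (hM t ht).trans (le_mul_of_one_le_left hM0 (Real.one_le_exp ?_))
      exact mul_nonneg hκ0.le (intervalIntegral.integral_nonneg ht.1 fun s _ => sq_nonneg _)
    | succ n ih =>
      intro t ht
      have := hP.weighted_contraction hlow hp (by linarith) hκ0 hdc ih ht (hmodes t ht)
      rwa [norm_neg, div_div, ← pow_succ] at this
  have hlim : Tendsto (fun n : ℕ => Real.exp (κ * ∫ r in (0 : ℝ)..t, p r ^ 2) * (M / 2 ^ n))
      atTop (𝓝 0) := by
    have h := (tendsto_inv_atTop_zero.comp
      (tendsto_pow_atTop_atTop_of_one_lt (one_lt_two : (1 : ℝ) < 2))).const_mul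
        (Real.exp (κ * ∫ r in (0 : ℝ)..t, p r ^ 2) * M)
    simpa only [mul_zero, mul_assoc, div_eq_mul_inv, Function.comp_def] using h
  have h0 : ‖d t‖ ≤ 0 := ge_of_tendsto' hlim fun n => hiter n t ht
  exact sub_eq_zero.1 (norm_le_zero_iff.1 h0)

theorem SpectralFamily.exists_modalSolution (hP : SpectralFamily P)
    (hlow : ∀ μ, P μ ≠ 0 → 0 ≤ μ) (hT : 0 ≤ T) (hp : MemLp p 2 (volume.restrict (Ioc 0 T)))
    (z₀ : X) : ∃ z, IsModalSolution P C p T z₀ z := by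
  obtain ⟨y, hyc, hy⟩ := hP.exists_orbit hlow z₀
  have hsubI : Icc (0 : ℝ) T ⊆ Ici 0 := fun s hs => hs.1
  set κ := 2 * (T + 1 / 2) * ‖C‖ ^ 2 + 1 with hκ
  have hκ0 : 0 < κ := by positivity
  set G : ℝ → ℝ := fun s => ∫ r in (0 : ℝ)..s, p r ^ 2 with hG
  have hGc : ContinuousOn G (Icc 0 T) := by
    have := intervalIntegral.continuousOn_primitive_interval' (μ := volume)
      ((intervalIntegrable_iff_integrableOn_Ioc_of_le hT).2 hp.integrable_sq) left_mem_uIcc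
    rwa [uIcc_of_le hT] at this
  -- The fixed point is sought for exp(−κG) z: its plain sup norm is the weighted norm of z, so the
  -- standard contraction principle applies on the complete space of continuous functions.
  set ext : C(Icc (0 : ℝ) T, X) → ℝ → X :=
    fun u s => Real.exp (κ * G s) • IccExtend hT u s with hext
  have hextc : ∀ u, ContinuousOn (ext u) (Icc 0 T) := fun u =>
    ContinuousOn.smul (Real.continuous_exp.comp_continuousOn (hGc.const_mul _))
      u.continuous.Icc_extend'.continuousOn
  have hmem : ∀ u, MemLp (fun s => p s • C (ext u s)) 2 (volume.restrict (Ioc 0 T)) := fun u =>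
    memLp_smul_of_continuousOn hp (C.continuous.comp_continuousOn (hextc u))
  choose w hwc hw using fun u => hP.exists_duhamel hlow hT (hmem u)
  let Φ : C(Icc (0 : ℝ) T, X) → C(Icc (0 : ℝ) T, X) := fun u =>
    { toFun := fun t => Real.exp (-(κ * G t)) • (y t - w u t)
      continuous_toFun := continuousOn_iff_continuous_domRestrict.1 <|
        ContinuousOn.smul (Real.continuous_exp.comp_continuousOn (hGc.const_mul _).neg)
          ((hyc.mono hsubI).sub (hwc u)) }
  have hΦ : ContractingWith (1 / 2) Φ := by
    refine ⟨by norm_num, LipschitzWith.of_dist_le_mul fun u v => ?_⟩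
    refine (ContinuousMap.dist_le (by positivity)).2 fun t => ?_
    have hdist : ∀ s ∈ Icc 0 T, ‖ext u s - ext v s‖ ≤ Real.exp (κ * G s) * dist u v := by
      intro s hs
      rw [hext, ← smul_sub, norm_smul, Real.norm_of_nonneg (Real.exp_pos _).le, ← dist_eq_norm]
      exact mul_le_mul_of_nonneg_left (ContinuousMap.dist_apply_le_dist _) (Real.exp_pos _).le
    have hmodes : ∀ μ, P μ (w u t - w v t) = ∫ s in (0 : ℝ)..t,
        modeKernel 0 μ (t - s) • P μ (p s • C (ext u s - ext v s)) := by
      intro μ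
      have hint : ∀ u, IntervalIntegrable
          (fun s => modeKernel 0 μ (t - s) • P μ (p s • C (ext u s))) volume 0 t := fun u =>
        intervalIntegrable_modeKernel_smul t.2.1
          (((hmem u).integrable one_le_two).mono_measure
            (Measure.restrict_mono (Ioc_subset_Ioc_right t.2.2) le_rfl))
      simp only [map_sub, smul_sub]
      rw [intervalIntegral.integral_sub (hint u) (hint v), hw u t t.2, hw v t t.2]
    have h := hP.weighted_contraction hlow hp (by linarith) hκ0 ((hextc u).sub (hextc v)) hdist
      t.2 hmodes
    have h1 : Φ u t - Φ v t = Real.exp (-(κ * G t)) • -(w u t - w v t) := by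
      change Real.exp (-(κ * G t)) • (y t - w u t) - Real.exp (-(κ * G t)) • (y t - w v t) = _
      rw [← smul_sub]
      congr 1
      abel
    rw [dist_eq_norm, h1, norm_smul, norm_neg, Real.norm_of_nonneg (Real.exp_pos _).le]
    refine (mul_le_mul_of_nonneg_left h (Real.exp_pos _).le).trans_eq ?_
    rw [← mul_assoc, ← Real.exp_add]
    simp only [hG, neg_add_cancel, Real.exp_zero, one_mul]
    push_cast
    ring
  refine ⟨ext (hΦ.fixedPoint Φ), hextc _, fun t ht μ => ?_⟩
  have hfix : Φ (hΦ.fixedPoint Φ) = hΦ.fixedPoint Φ := hΦ.fixedPoint_isFixedPt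
  have h1 : ext (hΦ.fixedPoint Φ) t = y t - w (hΦ.fixedPoint Φ) t := by
    have h2 := congrArg (fun f : C(Icc (0 : ℝ) T, X) => f ⟨t, ht⟩) hfix
    simp only [hext, IccExtend_of_mem hT _ ht]
    rw [← h2]
    change Real.exp (κ * G t) • Real.exp (-(κ * G t)) • (y t - w (hΦ.fixedPoint Φ) t) = _
    rw [smul_smul, ← Real.exp_add, add_neg_cancel, Real.exp_zero, one_smul]
  rw [h1, map_sub, hy t ht.1, hw _ t ht]

end Wellposed

end

/-! ### One step of the iteration around the ground state. -/

section

variable {X : Type*} [NormedAddCommGroup X] [InnerProductSpace ℝ X] [CompleteSpace X]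
  {P : ℝ → X →L[ℝ] X} {C : X →L[ℝ] X} {p : ℝ → ℝ} {T : ℝ}

/-- The constant is (1 + lam)(t − a) + 1/2 with t − a ≤ 1; this is where time intervals of length at
most one are required. -/
theorem SpectralFamily.norm_le_of_duhamel (hP : SpectralFamily P) {lam CB : ℝ} (hlam : 0 ≤ lam)
    (hlow : ∀ μ, P μ ≠ 0 → lam ≤ μ) (hC : ∀ x, ‖C x‖ ≤ CB * ‖x‖) (hCB : 0 ≤ CB)
    {a t m H : ℝ} (hat : a ≤ t) (hat1 : t ≤ a + 1) (hm : 0 ≤ m)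
    (hp : MemLp p 2 (volume.restrict (Ioc a t))) (hpm : ∫ s in a..t, p s ^ 2 ≤ m ^ 2)
    {h : ℝ → X} (hh : ContinuousOn h (Icc a t)) (hH : ∀ s ∈ Icc a t, ‖h s‖ ≤ H) {x : X}
    (hx : ∀ μ, P μ x = ∫ s in a..t, modeKernel lam μ (t - s) • P μ (p s • C (h s))) :
    ‖x‖ ≤ Real.sqrt (3 / 2 + lam) * CB * m * H := by
  have hH0 : 0 ≤ H := (norm_nonneg _).trans (hH a ⟨le_rfl, hat⟩)
  have hmem : MemLp (fun s => p s • C (h s)) 2 (volume.restrict (Ioc a t)) :=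
    memLp_smul_of_continuousOn hp (C.continuous.comp_continuousOn hh)
  have h1 := hP.norm_sq_le_of_modes hlam hlow hat hmem hx
  have h2 : ∫ s in a..t, ‖p s • C (h s)‖ ^ 2 ≤ ∫ s in a..t, (CB * H) ^ 2 * p s ^ 2 := by
    refine intervalIntegral.integral_mono_on hat ?_ ?_ fun s hs => ?_
    · exact (intervalIntegrable_iff_integrableOn_Ioc_of_le hat).2
        (hmem.integrable_norm_pow two_ne_zero)
    · exact ((intervalIntegrable_iff_integrableOn_Ioc_of_le hat).2 hp.integrable_sq).const_mul _
    · have h3 : ‖C (h s)‖ ≤ CB * H := (hC _).trans (mul_le_mul_of_nonneg_left (hH s hs) hCB)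
      rw [norm_smul, mul_pow, Real.norm_eq_abs, sq_abs, mul_comm]
      exact mul_le_mul_of_nonneg_right (pow_le_pow_left₀ (norm_nonneg _) h3 2) (sq_nonneg _)
  rw [intervalIntegral.integral_const_mul] at h2
  refine le_of_sq_le_sq ?_ (by positivity)
  calc ‖x‖ ^ 2 ≤ ((1 + lam) * (t - a) + 1 / 2) * ((CB * H) ^ 2 * m ^ 2) := by
        refine h1.trans (mul_le_mul_of_nonneg_left
          (h2.trans (mul_le_mul_of_nonneg_left hpm (sq_nonneg _))) ?_)
        have := mul_nonneg (by linarith : 0 ≤ 1 + lam) (sub_nonneg.2 hat)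
        linarith
    _ ≤ (3 / 2 + lam) * ((CB * H) ^ 2 * m ^ 2) := by
        refine mul_le_mul_of_nonneg_right ?_ (by positivity)
        nlinarith
    _ = _ := by
        simp only [mul_pow]
        rw [Real.sq_sqrt (by linarith)]
        ring

theorem modeKernel_eq (lam μ r : ℝ) :
    modeKernel lam μ r = Real.exp (lam * r) * modeKernel 0 μ r := by
  rw [modeKernel, modeKernel, mul_left_comm, ← Real.exp_add]
  ring_nf

theorem modeKernel_add (lam μ r r' : ℝ) :
    modeKernel lam μ (r + r') = Real.exp (-((μ - lam) * r)) * modeKernel lam μ r' := by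
  rw [modeKernel, modeKernel, mul_left_comm, ← Real.exp_add]
  ring_nf

omit [CompleteSpace X] in
/-- The deviation `v = e^{lam t} z - ζ` from the ground state satisfies a shifted equation, which
can be restarted at any time. -/
theorem IsModalSolution.restart (hp : MemLp p 2 (volume.restrict (Ioc 0 T))) {z₀ : X} {z : ℝ → X}
    (hz : IsModalSolution P C p T z₀ z) {lam : ℝ} {ζ : X} (hζ : ∀ μ, μ ≠ lam → P μ ζ = 0)
    {a t : ℝ} (ha : 0 ≤ a) (hat : a ≤ t) (htT : t ≤ T) (μ : ℝ) :
    P μ (Real.exp (lam * t) • z t - ζ) =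
      Real.exp (-((μ - lam) * (t - a))) • P μ (Real.exp (lam * a) • z a - ζ) -
        ∫ s in a..t, modeKernel lam μ (t - s) • P μ (p s • C (Real.exp (lam * s) • z s)) := by
  -- The shifted semigroup fixes ζ, which lives in the single mode μ = lam.
  have hζ' : Real.exp (-((μ - lam) * (t - a))) • P μ ζ = P μ ζ := by
    by_cases h : μ = lam
    · rw [h]; simp
    · rw [hζ μ h, smul_zero]
  have hint : IntegrableOn (fun s => p s • C (z s)) (Ioc 0 T) :=
    (memLp_smul_of_continuousOn hp (C.continuous.comp_continuousOn hz.cont)).integrable one_le_two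
  have hi1 : IntervalIntegrable (fun s => modeKernel 0 μ (t - s) • P μ (p s • C (z s)))
      volume 0 a :=
    intervalIntegrable_modeKernel_smul ha (hint.mono_set (Ioc_subset_Ioc_right (hat.trans htT)))
  have hi2 : IntervalIntegrable (fun s => modeKernel 0 μ (t - s) • P μ (p s • C (z s)))
      volume a t :=
    intervalIntegrable_modeKernel_smul hat (hint.mono_set (Ioc_subset_Ioc ha htT))
  have e1 : ∫ s in (0 : ℝ)..a, modeKernel 0 μ (t - s) • P μ (p s • C (z s)) =
      Real.exp (-(μ * (t - a))) •
        ∫ s in (0 : ℝ)..a, modeKernel 0 μ (a - s) • P μ (p s • C (z s)) := by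
    rw [← intervalIntegral.integral_smul]
    refine intervalIntegral.integral_congr fun s _ => ?_
    have : t - s = (t - a) + (a - s) := by ring
    simp only [smul_smul]
    rw [this, modeKernel_add, sub_zero]
  have e2 : ∫ s in a..t, modeKernel lam μ (t - s) • P μ (p s • C (Real.exp (lam * s) • z s)) =
      Real.exp (lam * t) • ∫ s in a..t, modeKernel 0 μ (t - s) • P μ (p s • C (z s)) := by
    rw [← intervalIntegral.integral_smul]
    refine intervalIntegral.integral_congr fun s _ => ?_
    have : Real.exp (lam * t) = Real.exp (lam * (t - s)) * Real.exp (lam * s) := by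
      rw [← Real.exp_add]; ring_nf
    simp only [map_smul, smul_smul]
    rw [modeKernel_eq, this]
    ring_nf
  have e3 : Real.exp (lam * t) * Real.exp (-(μ * t)) =
      Real.exp (-((μ - lam) * (t - a))) * (Real.exp (lam * a) * Real.exp (-(μ * a))) := by
    simp only [← Real.exp_add]; ring_nf
  have e4 : Real.exp (lam * t) * Real.exp (-(μ * (t - a))) =
      Real.exp (-((μ - lam) * (t - a))) * Real.exp (lam * a) := by
    simp only [← Real.exp_add]; ring_nf
  rw [e2, map_sub, map_sub, map_smul, map_smul, hz.eq t ⟨ha.trans hat, htT⟩,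
    hz.eq a ⟨ha, hat.trans htT⟩, ← intervalIntegral.integral_add_adjacent_intervals hi1 hi2, e1]
  simp only [smul_sub, hζ', smul_add, smul_smul, e3, e4]
  abel

/-- One step of the construction: a control that steers the linearized equation to zero makes
the deviation quadratically small. -/
theorem IsModalSolution.norm_step_le (hP : SpectralFamily P) {lam CB : ℝ} (hlam : 0 ≤ lam)
    (hlow : ∀ μ, P μ ≠ 0 → lam ≤ μ) (hC : ∀ x, ‖C x‖ ≤ CB * ‖x‖) (hCB : 0 ≤ CB)
    (hp : MemLp p 2 (volume.restrict (Ioc 0 T))) {z₀ : X} {z : ℝ → X}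
    (hz : IsModalSolution P C p T z₀ z) {ζ : X} (hζ : ∀ μ, μ ≠ lam → P μ ζ = 0)
    {a b m : ℝ} (ha : 0 ≤ a) (hab : a ≤ b) (hbT : b ≤ T) (hab1 : b ≤ a + 1) (hm : 0 ≤ m)
    (hpm : ∫ s in a..b, p s ^ 2 ≤ m ^ 2) (hsmall : Real.sqrt (3 / 2 + lam) * CB * m ≤ 1 / 4)
    (hnull : ∀ μ, Real.exp (-((μ - lam) * (b - a))) • P μ (Real.exp (lam * a) • z a - ζ) =
      ∫ s in a..b, modeKernel lam μ (b - s) • P μ (p s • C ζ)) :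
    ‖Real.exp (lam * b) • z b - ζ‖ ≤ 4 / 3 * (Real.sqrt (3 / 2 + lam) * CB * m) *
      (‖Real.exp (lam * a) • z a - ζ‖ + Real.sqrt (3 / 2 + lam) * CB * m * ‖ζ‖) := by
  set e := Real.sqrt (3 / 2 + lam) * CB * m with he
  have he0 : 0 ≤ e := by positivity
  set y : ℝ → X := fun t => Real.exp (lam * t) • z t with hy
  set v : ℝ → X := fun t => y t - ζ with hv
  have hyc : ContinuousOn y (Icc a b) :=
    ContinuousOn.smul (by fun_prop) (hz.cont.mono (Icc_subset_Icc ha hbT))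
  have hvc : ContinuousOn v (Icc a b) := hyc.sub continuousOn_const
  have hpi : ∀ t ∈ Icc a b, MemLp p 2 (volume.restrict (Ioc a t)) := fun t ht =>
    hp.mono_measure (Measure.restrict_mono (Ioc_subset_Ioc ha (ht.2.trans hbT)) le_rfl)
  have hpm' : ∀ t ∈ Icc a b, ∫ s in a..t, p s ^ 2 ≤ m ^ 2 := fun t ht =>
    (intervalIntegral.integral_mono_interval le_rfl ht.1 ht.2 (.of_forall fun s => sq_nonneg _)
      ((intervalIntegrable_iff_integrableOn_Ioc_of_le hab).2
        (hpi b ⟨hab, le_rfl⟩).integrable_sq)).trans hpm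
  -- At a maximum of ‖v‖ the term e ‖v t₀‖ can be absorbed on the left; e ≤ 1/4 produces the factor
  -- 4/3.
  obtain ⟨t₀, ht₀, hmax⟩ := isCompact_Icc.exists_isMaxOn ⟨a, le_rfl, hab⟩ hvc.norm
  have hV : ∀ s ∈ Icc a b, ‖v s‖ ≤ ‖v t₀‖ := fun s hs => hmax hs
  have hrestart : ∀ t ∈ Icc a b, ∀ μ, P μ (v t) =
      Real.exp (-((μ - lam) * (t - a))) • P μ (v a) -
        ∫ s in a..t, modeKernel lam μ (t - s) • P μ (p s • C (y s)) := fun t ht μ =>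
    hz.restart hp hζ ha ht.1 (ht.2.trans hbT) μ
  have hbound : ‖v t₀‖ ≤ ‖v a‖ + e * (‖v t₀‖ + ‖ζ‖) := by
    obtain ⟨M, hM, hM1⟩ := hP.exists_multiplier
      (f := fun μ => Real.exp (-((μ - lam) * (t₀ - a)))) fun μ hμ => by
        rw [abs_of_pos (Real.exp_pos _), Real.exp_le_one_iff]
        have := mul_nonneg (sub_nonneg.2 (hlow μ hμ)) (sub_nonneg.2 ht₀.1)
        linarith
    have hW := hP.norm_le_of_duhamel hlam hlow hC hCB ht₀.1 (ht₀.2.trans hab1) hm (hpi t₀ ht₀)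
      (hpm' t₀ ht₀) (hyc.mono (Icc_subset_Icc_right ht₀.2)) (H := ‖v t₀‖ + ‖ζ‖)
      (fun s hs => by
        have h1 : y s = v s + ζ := (sub_add_cancel _ _).symm
        rw [h1]
        exact (norm_add_le _ _).trans (by linarith [hV s ⟨hs.1, hs.2.trans ht₀.2⟩]))
      (x := M (v a) - v t₀) (fun μ => by rw [map_sub, hM, hrestart t₀ ht₀]; abel)
    have h2 : ‖v t₀‖ ≤ ‖M (v a)‖ + ‖M (v a) - v t₀‖ := by
      have := norm_sub_le (M (v a)) (M (v a) - v t₀)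
      rwa [sub_sub_cancel] at this
    linarith [hM1 (v a)]
  have hVle : ‖v t₀‖ ≤ 4 / 3 * (‖v a‖ + e * ‖ζ‖) := by
    have : e * ‖v t₀‖ ≤ 1 / 4 * ‖v t₀‖ := mul_le_mul_of_nonneg_right hsmall (norm_nonneg _)
    linarith
  have hb : b ∈ Icc a b := ⟨hab, le_rfl⟩
  -- The forcing is p C y = p C ζ + p C v. The first term cancels the free evolution of v a by the
  -- choice of control, so only p C v remains.
  have hfin := hP.norm_le_of_duhamel hlam hlow hC hCB hab hab1 hm (hpi b hb) hpm hvc hV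
    (x := -v b) (fun μ => by
      have hi : ∀ h : ℝ → X, ContinuousOn h (Icc a b) → IntervalIntegrable
          (fun s => modeKernel lam μ (b - s) • P μ (p s • C (h s))) volume a b := fun h hh =>
        intervalIntegrable_modeKernel_smul hab ((memLp_smul_of_continuousOn (hpi b hb)
          (C.continuous.comp_continuousOn hh)).integrable one_le_two)
      rw [map_neg, hrestart b hb, hnull, neg_sub,
        ← intervalIntegral.integral_sub (hi y hyc) (hi (fun _ => ζ) continuousOn_const)]
      simp only [hv, map_sub, smul_sub])
  rw [norm_neg] at hfin
  calc ‖v b‖ ≤ e * ‖v t₀‖ := hfin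
    _ ≤ e * (4 / 3 * (‖v a‖ + e * ‖ζ‖)) := mul_le_mul_of_nonneg_left hVle he0
    _ = _ := by ring

end

/-! ### Gluing controls, and the numerical recursion. -/

section

/-- At each s at most one term is nonzero, so the square of the sum is the sum of the squares and
the integral may be taken termwise. -/
theorem memLp_tsum_of_disjoint {q : ℕ → ℝ → ℝ} {r : ℕ → ℝ} (hq : ∀ k, MemLp (q k) 2 volume)
    (hdisj : ∀ s, ∃ k, ∀ j, j ≠ k → q j s = 0) (hr : ∀ k, ∫ s, q k s ^ 2 ≤ r k)
    (hrs : Summable r) :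
    MemLp (fun s => ∑' k, q k s) 2 volume ∧ ∫ s, (∑' k, q k s) ^ 2 ≤ ∑' k, r k := by
  have hsum : ∀ s, Summable fun k => q k s := fun s => by
    obtain ⟨k, hk⟩ := hdisj s
    exact (hasSum_single k hk).summable
  have hsq : ∀ s, (∑' k, q k s) ^ 2 = ∑' k, q k s ^ 2 := fun s => by
    obtain ⟨k, hk⟩ := hdisj s
    rw [tsum_eq_single k hk, tsum_eq_single k fun j hj => by rw [hk j hj]; simp]
  have hmeas : AEStronglyMeasurable (fun s => ∑' k, q k s) volume := by
    refine aestronglyMeasurable_of_tendsto_ae atTop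
      (f := fun (n : ℕ) s => ∑ k ∈ Finset.range n, q k s) (fun n => ?_)
      (.of_forall fun s => (hsum s).hasSum.tendsto_sum_nat)
    exact Finset.aestronglyMeasurable_fun_sum _ fun k _ => (hq k).1
  have hint : ∀ k, Integrable (fun s => q k s ^ 2) volume := fun k => (hq k).integrable_sq
  have hnn : ∀ k, 0 ≤ ∫ s, q k s ^ 2 := fun k => integral_nonneg fun s => sq_nonneg _
  have hsi : Summable fun k => ∫ s, q k s ^ 2 := hrs.of_nonneg_of_le hnn hr
  constructor
  · refine (memLp_two_iff_integrable_sq hmeas).2 ⟨hmeas.pow 2, ?_⟩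
    have h1 : ∀ s, ‖(∑' k, q k s) ^ 2‖ₑ = ∑' k, ENNReal.ofReal (q k s ^ 2) := fun s => by
      obtain ⟨k, hk⟩ := hdisj s
      rw [tsum_eq_single k hk, tsum_eq_single k fun j hj => by rw [hk j hj]; simp,
        Real.enorm_of_nonneg (sq_nonneg _)]
    rw [HasFiniteIntegral, lintegral_congr h1,
      lintegral_tsum fun k => (hint k).1.aemeasurable.ennreal_ofReal]
    have h2 : ∀ k, ∫⁻ s, ENNReal.ofReal (q k s ^ 2) = ENNReal.ofReal (∫ s, q k s ^ 2) := fun k =>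
      (ofReal_integral_eq_lintegral_ofReal (hint k) (.of_forall fun s => sq_nonneg _)).symm
    simp only [h2]
    rw [← ENNReal.ofReal_tsum_of_nonneg hnn hsi]
    exact ENNReal.ofReal_lt_top
  · have hnorm : ∀ k s, ‖q k s ^ 2‖ = q k s ^ 2 := fun k s => Real.norm_of_nonneg (sq_nonneg _)
    have h := hasSum_integral_of_summable_integral_norm hint (by simpa only [hnorm] using hsi)
    simp only [hsq]
    rw [← h.tsum_eq]
    exact hsi.tsum_le_tsum hr hrs

/-- The numerical relations behind the convergence of the construction. -/
theorem step_bounds {lam ν L x c Γ T₁ K Z : ℝ} (hlam : 0 ≤ lam) (hν : 0 < ν) (hL : 0 ≤ L)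
    (hc1 : 1 ≤ c) (hc : c ≤ 3 / 2) (hcx : c ^ 2 ≤ Real.exp x) (hx : 0 < x)
    (hΓ : Γ = 2 * ν + 3 * lam + L) (hT₁ : 0 < T₁) (hT₁1 : T₁ ≤ 1) (hxg : x ≤ Γ / T₁)
    (hK : 0 ≤ K) (hZ : 0 ≤ Z) (hK1 : 6 * K ≤ Real.exp (lam + L))
    (hK2 : 3 * K * (1 + K * Z) ≤ Real.exp (lam + L)) (n : ℕ) {τ b m : ℝ}
    (hτ : τ = T₁ / (n + 1 : ℝ) ^ 2)
    (hb : b = Real.exp (-((n ^ 2 + 4 * n + 6) * (Γ / T₁))))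
    (hm : m = c * Real.exp (lam * τ + ν / τ) * b) :
    K * m ≤ 1 / 4 ∧
    4 / 3 * (K * m) * (b + K * m * Z) ≤
      Real.exp (-(((n + 1 : ℝ) ^ 2 + 4 * (n + 1 : ℝ) + 6) * (Γ / T₁))) ∧
    m ^ 2 ≤ Real.exp (-((4 * n + 10) * x)) := by
  set g := Γ / T₁ with hg
  set k := (n + 1 : ℝ) ^ 2 / T₁ with hk
  have hn : (0 : ℝ) ≤ n := n.cast_nonneg
  have hk1 : 1 ≤ k := by
    rw [hk, le_div_iff₀ hT₁]; nlinarith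
  -- Here k = (n+1)²/T₁ is 1/τ. Everything below rests on Γk = g(n+1)² and k ≥ 1.
  have hΓk : Γ * k = g * (n + 1 : ℝ) ^ 2 := by rw [hg, hk]; ring
  have hg0 : 0 < g := hx.trans_le hxg
  have hτ1 : τ ≤ k := by
    have : τ ≤ 1 := by
      rw [hτ, div_le_one (by positivity)]; nlinarith
    linarith
  have hντ : ν / τ = ν * k := by
    rw [hτ, hk]; field_simp
  set E := Real.exp ((lam + ν) * k) with hE
  set M := c * Real.exp (lam * τ + ν / τ) with hM
  have hb0 : 0 < b := by rw [hb]; exact Real.exp_pos _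
  have hτ0 : 0 < τ := by rw [hτ]; positivity
  have hM1 : 1 ≤ M := by
    have : 1 ≤ Real.exp (lam * τ + ν / τ) := Real.one_le_exp (by positivity)
    nlinarith
  have hME : M ≤ c * E := by
    refine mul_le_mul_of_nonneg_left (Real.exp_le_exp.2 ?_) (by linarith)
    rw [hντ, add_mul]
    have := mul_le_mul_of_nonneg_left hτ1 hlam
    linarith
  have hE0 : 0 < E := Real.exp_pos _
  have hm0 : 0 ≤ m := by rw [hm]; positivity
  have hlamk : lam ≤ lam * k := le_mul_of_one_le_right hlam hk1
  have hLk : L ≤ L * k := le_mul_of_one_le_right hL hk1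
  have hνk : 0 ≤ ν * k := by positivity
  have hΓk' : Γ * k = 2 * (ν * k) + 3 * (lam * k) + L * k := by rw [hΓ]; ring
  refine ⟨?_, ?_, ?_⟩
  · have h1 : Real.exp (lam + L) * (E * b) ≤ 1 := by
      rw [hE, hb, ← Real.exp_add, ← Real.exp_add, Real.exp_le_one_iff]
      nlinarith [mul_nonneg hg0.le hn]
    calc K * m = K * M * b := by rw [hm]; ring
      _ ≤ (Real.exp (lam + L) / 6) * (3 / 2 * E) * b := by
          have h3 : M ≤ 3 / 2 * E := hME.trans (mul_le_mul_of_nonneg_right hc hE0.le)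
          have h4 : K ≤ Real.exp (lam + L) / 6 := by linarith
          gcongr
      _ = (Real.exp (lam + L) * (E * b)) / 4 := by ring
      _ ≤ 1 / 4 := by linarith
  -- The exponent balances exactly: 2(n² + 4n + 6) − (n+1)² = (n+1)² + 4(n+1) + 6. The growth to be
  -- paid for, 2(lam + ν)k + lam + L, is at most Γk, which explains the form of Γ.
  · have h1 : Real.exp (lam + L) * (E ^ 2 * b ^ 2) ≤
        Real.exp (-(((n + 1 : ℝ) ^ 2 + 4 * (n + 1 : ℝ) + 6) * g)) := by
      rw [hE, hb, ← Real.exp_nat_mul, ← Real.exp_nat_mul, ← Real.exp_add, ← Real.exp_add,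
        Real.exp_le_exp]
      push_cast
      nlinarith
    refine le_trans ?_ h1
    have hM2 : M ^ 2 ≤ 9 / 4 * E ^ 2 := by
      have h3 : M ≤ 3 / 2 * E := hME.trans (mul_le_mul_of_nonneg_right hc hE0.le)
      calc M ^ 2 ≤ (3 / 2 * E) ^ 2 := pow_le_pow_left₀ (by linarith) h3 2
        _ = _ := by ring
    calc 4 / 3 * (K * m) * (b + K * m * Z) = 4 / 3 * K * b ^ 2 * (M * (1 + K * M * Z)) := by
          rw [hm]; ring
      _ ≤ 4 / 3 * K * b ^ 2 * (M * (M + K * M * Z)) := by gcongr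
      _ = 4 / 3 * K * (1 + K * Z) * b ^ 2 * M ^ 2 := by ring
      _ ≤ 4 / 3 * K * (1 + K * Z) * b ^ 2 * (9 / 4 * E ^ 2) := by gcongr
      _ = (3 * K * (1 + K * Z)) * (E ^ 2 * b ^ 2) := by ring
      _ ≤ _ := by gcongr
  -- Here E² b² ≤ exp(−(n² + 6n + 11)g), and n² + 6n + 11 ≥ (4n + 10) + 1. The extra unit pays for
  -- c² ≤ exp x.
  · have h5 := mul_le_mul_of_nonneg_right hxg (by positivity : (0 : ℝ) ≤ 4 * n + 10)
    have h6 := mul_nonneg hg0.le (sq_nonneg (n : ℝ))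
    have h7 := mul_nonneg hg0.le hn
    have h8 : Real.exp x * (E ^ 2 * b ^ 2) ≤ Real.exp (-((4 * n + 10) * x)) := by
      rw [hE, hb, ← Real.exp_nat_mul, ← Real.exp_nat_mul, ← Real.exp_add, ← Real.exp_add,
        Real.exp_le_exp]
      push_cast
      linarith
    calc m ^ 2 = M ^ 2 * b ^ 2 := by rw [hm]; ring
      _ ≤ (c * E) ^ 2 * b ^ 2 := by gcongr
      _ = c ^ 2 * (E ^ 2 * b ^ 2) := by ring
      _ ≤ Real.exp x * (E ^ 2 * b ^ 2) := mul_le_mul_of_nonneg_right hcx (by positivity)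
      _ ≤ _ := h8

theorem hasSum_geometric_exp {x : ℝ} (hx : 0 < x) :
    HasSum (fun n : ℕ => Real.exp (-((4 * n + 10) * x)))
      (Real.exp (-(6 * x)) / (Real.exp (4 * x) - 1)) := by
  have h1 : Real.exp (-(4 * x)) < 1 := by
    rw [← Real.exp_zero]; exact Real.exp_lt_exp.2 (by linarith)
  have h := (hasSum_geometric_of_lt_one (Real.exp_pos _).le h1).mul_left (Real.exp (-(10 * x)))
  have e1 : ∀ n : ℕ, Real.exp (-((4 * n + 10) * x)) =
      Real.exp (-(10 * x)) * Real.exp (-(4 * x)) ^ n := fun n => by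
    rw [← Real.exp_nat_mul, ← Real.exp_add]
    ring_nf
  have h4 : 1 < Real.exp (4 * x) := Real.one_lt_exp_iff.2 (by linarith)
  have e2 : Real.exp (-(6 * x)) / (Real.exp (4 * x) - 1) =
      Real.exp (-(10 * x)) * (1 - Real.exp (-(4 * x)))⁻¹ := by
    have e3 : Real.exp (-(6 * x)) = Real.exp (-(10 * x)) * Real.exp (4 * x) := by
      rw [← Real.exp_add]; ring_nf
    rw [e3, Real.exp_neg (4 * x), ← div_eq_mul_inv]
    have h5 : Real.exp (4 * x) - 1 ≠ 0 := by linarith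
    have h6 : 1 - (Real.exp (4 * x))⁻¹ ≠ 0 := by
      rw [← Real.exp_neg]; linarith
    field_simp
  rw [e2]
  simpa only [e1] using h

end

/-! ### Construction of the control by infinitely many steering steps. -/

section

/-- The switching times `T₁ ∑_{k < n} (k + 1)⁻²`. -/
noncomputable def switchTime (T₁ : ℝ) (n : ℕ) : ℝ := ∑ k ∈ Finset.range n, T₁ / (k + 1 : ℝ) ^ 2

theorem switchTime_succ (T₁ : ℝ) (n : ℕ) :
    switchTime T₁ (n + 1) = switchTime T₁ n + T₁ / (n + 1 : ℝ) ^ 2 :=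
  Finset.sum_range_succ _ _

theorem hasSum_switchTime (T₁ : ℝ) :
    HasSum (fun k : ℕ => T₁ / (k + 1 : ℝ) ^ 2) (T₁ * (Real.pi ^ 2 / 6)) := by
  have h := (hasSum_nat_add_iff' 1).2 hasSum_zeta_two
  simp only [Finset.range_one, Finset.sum_singleton, Nat.cast_zero, ne_eq, OfNat.ofNat_ne_zero,
    not_false_eq_true, zero_pow, div_zero, sub_zero, Nat.cast_add, Nat.cast_one] at h
  simpa only [mul_one_div] using h.mul_left T₁

theorem tendsto_switchTime (T₁ : ℝ) :
    Tendsto (switchTime T₁) atTop (𝓝 (T₁ * (Real.pi ^ 2 / 6))) :=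
  (hasSum_switchTime T₁).tendsto_sum_nat

theorem strictMono_switchTime {T₁ : ℝ} (h : 0 < T₁) : StrictMono (switchTime T₁) :=
  strictMono_nat_of_lt_succ fun n => by
    rw [switchTime_succ]
    exact lt_add_of_pos_right _ (by positivity)

theorem switchTime_nonneg {T₁ : ℝ} (h : 0 < T₁) (n : ℕ) : 0 ≤ switchTime T₁ n :=
  Finset.sum_nonneg fun _ _ => by positivity

theorem switchTime_le {T₁ : ℝ} (h : 0 < T₁) (n : ℕ) :
    switchTime T₁ n ≤ T₁ * (Real.pi ^ 2 / 6) :=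
  (strictMono_switchTime h).monotone.ge_of_tendsto (tendsto_switchTime T₁) n

theorem exists_forall_ne_eq_zero {T₁ : ℝ} (hT₁ : 0 < T₁) {q : ℕ → ℝ → ℝ}
    (hq : ∀ n s, s ∉ Ioc (switchTime T₁ n) (switchTime T₁ (n + 1)) → q n s = 0) (s : ℝ) :
    ∃ k, ∀ j, j ≠ k → q j s = 0 := by
  by_cases h : ∃ k, s ∈ Ioc (switchTime T₁ k) (switchTime T₁ (k + 1))
  · obtain ⟨k, hk⟩ := h
    refine ⟨k, fun j hj => hq j s fun hj' => ?_⟩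
    have hmono := (strictMono_switchTime hT₁).monotone
    rcases lt_or_gt_of_ne hj with h1 | h1
    · exact lt_irrefl _ (hk.1.trans_le (hj'.2.trans (hmono (Nat.succ_le_of_lt h1))))
    · exact absurd (hj'.1.trans_le (hk.2.trans (hmono (Nat.succ_le_of_lt h1)))) (lt_irrefl _)
  · exact ⟨0, fun j _ => hq j s fun hj => h ⟨j, hj⟩⟩

variable {X : Type*} [NormedAddCommGroup X] [InnerProductSpace ℝ X] [CompleteSpace X]
  {P : ℝ → X →L[ℝ] X} {C : X →L[ℝ] X}

omit [CompleteSpace X] in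
theorem IsModalSolution.apply_zero {p : ℝ → ℝ} {T : ℝ} (hP : SpectralFamily P) (hT : 0 ≤ T)
    {z₀ : X} {z : ℝ → X} (hz : IsModalSolution P C p T z₀ z) : z 0 = z₀ :=
  hP.ext fun μ => by simpa using hz.eq 0 ⟨le_rfl, hT⟩ μ

/-- Solutions at time `a` only depend on the control on `(0, a]`. -/
theorem IsModalSolution.eq_of_eqOn {p p' : ℝ → ℝ} {T : ℝ} (hP : SpectralFamily P)
    (hlow : ∀ μ, P μ ≠ 0 → 0 ≤ μ) (hp : MemLp p 2 volume)
    {z₀ : X} {z z' : ℝ → X} (hz : IsModalSolution P C p T z₀ z)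
    (hz' : IsModalSolution P C p' T z₀ z') {a : ℝ} (ha : 0 ≤ a) (haT : a ≤ T)
    (hpp : ∀ s, s ≤ a → p' s = p s) : z a = z' a := by
  have h' : IsModalSolution P C p a z₀ z' := (hz'.mono haT).congr_control <|
    (ae_restrict_iff' measurableSet_Ioc).2 (.of_forall fun s hs => hpp s hs.2)
  exact (hz.mono haT).unique hP hlow (hp.restrict _) h' a ⟨ha, le_rfl⟩

/-- Local exact controllability for the modal equation, from the null controllability of the
linearized equation. -/
theorem SpectralFamily.exists_control (hP : SpectralFamily P) {lam CB : ℝ} (hlam : 0 ≤ lam)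
    (hlow : ∀ μ, P μ ≠ 0 → lam ≤ μ) (hC : ∀ x, ‖C x‖ ≤ CB * ‖x‖) (hCB : 0 ≤ CB)
    {ζ : X} (hζ : ∀ μ, μ ≠ lam → P μ ζ = 0)
    {ν L x c Γ T T₀ T₁ : ℝ} (hν : 0 < ν) (hL : 0 ≤ L)
    (hc1 : 1 ≤ c) (hc : c ≤ 3 / 2) (hcx : c ^ 2 ≤ Real.exp x) (hx : 0 < x)
    (hΓ : Γ = 2 * ν + 3 * lam + L) (hT₁ : 0 < T₁) (hT₁1 : T₁ ≤ 1) (hT₁0 : T₁ ≤ T₀)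
    (hT₁T : T₁ * (Real.pi ^ 2 / 6) ≤ T) (hxg : x ≤ Γ / T₁)
    (hK1 : 6 * (Real.sqrt (3 / 2 + lam) * CB) ≤ Real.exp (lam + L))
    (hK2 : 3 * (Real.sqrt (3 / 2 + lam) * CB) * (1 + Real.sqrt (3 / 2 + lam) * CB * ‖ζ‖) ≤
      Real.exp (lam + L))
    (hctrl : ∀ τ, 0 < τ → τ ≤ T₀ → ∀ v : X, ∃ q : ℝ → ℝ, MemLp q 2 volume ∧
      (∀ s, s ∉ Ioc 0 τ → q s = 0) ∧
      ∫ s, q s ^ 2 ≤ (c * Real.exp (lam * τ + ν / τ) * ‖v‖) ^ 2 ∧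
      ∀ μ, Real.exp (-((μ - lam) * τ)) • P μ v =
        ∫ s in (0 : ℝ)..τ, modeKernel lam μ (τ - s) • P μ (q s • C ζ))
    {z₀ : X} (hz₀ : ‖z₀ - ζ‖ ≤ Real.exp (-(6 * (Γ / T₁)))) :
    ∃ p : ℝ → ℝ, MemLp p 2 volume ∧
      ∫ s, p s ^ 2 ≤ Real.exp (-(6 * x)) / (Real.exp (4 * x) - 1) ∧
      ∀ z, IsModalSolution P C p T z₀ z → Real.exp (lam * T) • z T = ζ := by
  have hlow0 : ∀ μ, P μ ≠ 0 → 0 ≤ μ := fun μ h => hlam.trans (hlow μ h)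
  set a : ℕ → ℝ := switchTime T₁ with ha
  set τ : ℕ → ℝ := fun n => T₁ / (n + 1 : ℝ) ^ 2 with hτ
  have hτ0 : ∀ n, 0 < τ n := fun n => by positivity
  have hτT₁ : ∀ n, τ n ≤ T₁ := fun n => by
    have : (1 : ℝ) ≤ (n + 1 : ℝ) ^ 2 := one_le_pow₀ (by linarith [n.cast_nonneg (α := ℝ)])
    exact div_le_self hT₁.le this
  have ha0 : ∀ n, 0 ≤ a n := switchTime_nonneg hT₁
  have haT : ∀ n, a n ≤ T := fun n => (switchTime_le hT₁ n).trans hT₁T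
  have hT : 0 ≤ T := (ha0 0).trans (haT 0)
  have hsucc : ∀ n, a (n + 1) = a n + τ n := switchTime_succ T₁
  have hmono : Monotone a := (strictMono_switchTime hT₁).monotone
  choose ctl hctl_mem hctl_supp hctl_norm hctl_null using
    fun n => hctrl (τ n) (hτ0 n) ((hτT₁ n).trans hT₁0)
  -- A solution is selected for every function p, with a dummy value outside L², so that the
  -- recursion can be defined before its terms are known to be in L².
  have hsolex : ∀ p : ℝ → ℝ, ∃ z : ℝ → X, MemLp p 2 volume → IsModalSolution P C p T z₀ z := by
    intro p
    by_cases hp : MemLp p 2 volume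
    · obtain ⟨z, hz⟩ := hP.exists_modalSolution (C := C) hlow0 hT (hp.restrict _) z₀
      exact ⟨z, fun _ => hz⟩
    · exact ⟨0, fun h => absurd h hp⟩
  choose sol hsol using hsolex
  let v : ℕ → (ℝ → ℝ) → X := fun n p => Real.exp (lam * a n) • sol p (a n) - ζ
  let step : ℕ → (ℝ → ℝ) → ℝ → ℝ := fun n p s => ctl n (v n p) (s - a n)
  -- Feedback construction: the n-th piece steers the linearization from the deviation reached at `a
  -- n` under the control built so far.
  let pn : ℕ → ℝ → ℝ := fun n => Nat.rec 0 (fun n p => p + step n p) n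
  have hpn_succ : ∀ n, pn (n + 1) = pn n + step n (pn n) := fun n => rfl
  have hstep_mem : ∀ n p, MemLp (step n p) 2 volume := fun n p =>
    (hctl_mem n (v n p)).comp_measurePreserving (measurePreserving_sub_right volume (a n))
  have hstep_supp : ∀ n p s, s ∉ Ioc (a n) (a (n + 1)) → step n p s = 0 := fun n p s hs =>
    hctl_supp n _ _ fun h => hs ⟨by linarith [h.1], by rw [hsucc]; linarith [h.2]⟩
  have hpn_mem : ∀ n, MemLp (pn n) 2 volume := by
    intro n
    induction n with
    | zero => exact MemLp.zero
    | succ n ih => exact ih.add (hstep_mem n _)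
  have hpn_stop : ∀ n s, a n < s → pn n s = 0 := by
    intro n
    induction n with
    | zero => intro s _; rfl
    | succ n ih =>
      intro s hs
      rw [hpn_succ, Pi.add_apply, ih s ((hmono n.le_succ).trans_lt hs),
        hstep_supp n _ s fun h => absurd h.2 (not_le.2 hs), add_zero]
  have hpn_agree : ∀ n s, s ≤ a n → pn (n + 1) s = pn n s := fun n s hs => by
    rw [hpn_succ, Pi.add_apply, hstep_supp n _ s fun h => absurd h.1 (not_lt.2 hs), add_zero]
  set q : ℕ → ℝ → ℝ := fun n => step n (pn n) with hq
  set b : ℕ → ℝ := fun n => Real.exp (-((n ^ 2 + 4 * n + 6) * (Γ / T₁))) with hb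
  set m : ℕ → ℝ := fun n => c * Real.exp (lam * τ n + ν / τ n) * b n with hm
  have hm0 : ∀ n, 0 ≤ m n := fun n => by positivity
  have hnum := fun n : ℕ => step_bounds (K := Real.sqrt (3 / 2 + lam) * CB) (Z := ‖ζ‖) hlam hν hL
    hc1 hc hcx hx hΓ hT₁ hT₁1 hxg (by positivity) (norm_nonneg _) hK1 hK2 n (τ := τ n) (b := b n)
    (m := m n) rfl rfl rfl
  have hqm : ∀ n, ‖v n (pn n)‖ ≤ b n → ∫ s, q n s ^ 2 ≤ m n ^ 2 := by
    intro n hn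
    have h1 : ∫ s, q n s ^ 2 = ∫ s, ctl n (v n (pn n)) s ^ 2 :=
      integral_sub_right_eq_self (μ := volume) (fun s => ctl n (v n (pn n)) s ^ 2) (a n)
    rw [h1]
    refine (hctl_norm n _).trans (pow_le_pow_left₀ (by positivity) ?_ 2)
    exact mul_le_mul_of_nonneg_left hn (by positivity)
  have hvb : ∀ n, ‖v n (pn n)‖ ≤ b n := by
    intro n
    induction n with
    | zero =>
      have h0 : sol (pn 0) 0 = z₀ := (hsol _ (hpn_mem 0)).apply_zero hP hT
      have ha0' : a 0 = 0 := by simp [ha, switchTime]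
      simp only [v, hb, ha0', h0]
      simpa using hz₀
    | succ n ih =>
      have hz := hsol _ (hpn_mem (n + 1))
      -- Causality: the new piece acts only after `a n`, so the deviation from which it was computed
      -- is unchanged.
      have hagree : sol (pn (n + 1)) (a n) = sol (pn n) (a n) :=
        ((hsol _ (hpn_mem n)).eq_of_eqOn hP hlow0 (hpn_mem n) hz (ha0 n) (haT n)
          (hpn_agree n)).symm
      have hpq : ∀ s, a n < s → pn (n + 1) s = q n s := fun s hs => by
        rw [hpn_succ, Pi.add_apply, hpn_stop n s hs, zero_add]
      have hle : a n ≤ a (n + 1) := hmono n.le_succ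
      have hpm : ∫ s in a n..a (n + 1), pn (n + 1) s ^ 2 ≤ m n ^ 2 := by
        refine le_trans ?_ (hqm n ih)
        rw [intervalIntegral.integral_of_le hle,
          setIntegral_congr_fun (g := fun s => q n s ^ 2) measurableSet_Ioc
            (fun s hs => by rw [hpq s hs.1])]
        exact setIntegral_le_integral (hstep_mem n _).integrable_sq
          (.of_forall fun s => sq_nonneg _)
      have hnull : ∀ μ, Real.exp (-((μ - lam) * (a (n + 1) - a n))) •
          P μ (Real.exp (lam * a n) • sol (pn (n + 1)) (a n) - ζ) =
          ∫ s in a n..a (n + 1), modeKernel lam μ (a (n + 1) - s) •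
            P μ (pn (n + 1) s • C ζ) := by
        intro μ
        have h1 := hctl_null n (v n (pn n)) μ
        have h2 : a (n + 1) - a n = τ n := by rw [hsucc]; ring
        rw [hagree, h2]
        refine h1.trans ?_
        have h3 := intervalIntegral.integral_comp_sub_right (a := a n) (b := a (n + 1))
          (fun s => modeKernel lam μ (τ n - s) • P μ (ctl n (v n (pn n)) s • C ζ)) (a n)
        rw [sub_self, h2] at h3
        rw [← h3]
        refine intervalIntegral.integral_congr_ae (.of_forall fun s hs => ?_)
        rw [uIoc_of_le hle] at hs
        have h4 : τ n - (s - a n) = a (n + 1) - s := by rw [hsucc]; ring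
        rw [h4, hpq s hs.1]
      have h := hz.norm_step_le hP hlam hlow hC hCB ((hpn_mem (n + 1)).restrict _) hζ (ha0 n) hle
        (haT _) (by rw [hsucc]; linarith [hτT₁ n]) (hm0 n) hpm (hnum n).1 hnull
      rw [hagree] at h
      refine h.trans (le_trans ?_ ((hnum n).2.1.trans_eq ?_))
      · have : 0 ≤ Real.sqrt (3 / 2 + lam) * CB * m n := mul_nonneg (by positivity) (hm0 n)
        refine mul_le_mul_of_nonneg_left (add_le_add ih le_rfl) (by positivity)
      · simp only [hb]; push_cast; rfl
  have hdisj : ∀ s, ∃ k, ∀ j, j ≠ k → q j s = 0 :=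
    exists_forall_ne_eq_zero hT₁ fun n s => hstep_supp n _ s
  have hgeom := hasSum_geometric_exp hx
  obtain ⟨hp_mem, hp_norm⟩ := memLp_tsum_of_disjoint (fun n => hstep_mem n (pn n)) hdisj
    (fun n => (hqm n (hvb n)).trans (hnum n).2.2) hgeom.summable
  rw [hgeom.tsum_eq] at hp_norm
  set p : ℝ → ℝ := fun s => ∑' k, q k s with hp
  have hpn_sum : ∀ n s, pn n s = ∑ k ∈ Finset.range n, q k s := by
    intro n s
    induction n with
    | zero => rfl
    | succ n ih => rw [hpn_succ, Pi.add_apply, ih, Finset.sum_range_succ]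
  have hp_agree : ∀ n s, s ≤ a n → p s = pn n s := by
    intro n s hs
    rw [hpn_sum]
    refine tsum_eq_sum fun k hk => hstep_supp k _ s fun h => ?_
    have hnk : n ≤ k := by simpa using hk
    exact absurd h.1 (not_lt.2 (hs.trans (hmono hnk)))
  set t' := T₁ * (Real.pi ^ 2 / 6) with ht'
  have ht'0 : 0 ≤ t' := by positivity
  have hp_stop : ∀ s, t' < s → p s = 0 := by
    intro s hs
    rw [hp]
    refine (tsum_congr fun k => hstep_supp k _ s fun h => ?_).trans tsum_zero
    exact absurd (h.2.trans (switchTime_le hT₁ _)) (not_le.2 hs)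
  refine ⟨p, hp_mem, hp_norm, fun z hz => ?_⟩
  have hzv : ∀ n, ‖Real.exp (lam * a n) • z (a n) - ζ‖ ≤ b n := by
    intro n
    have h := (hsol _ (hpn_mem n)).eq_of_eqOn hP hlow0 (hpn_mem n) hz (ha0 n) (haT n)
      (hp_agree n)
    rw [← h]
    exact hvb n
  have hb_lim : Tendsto b atTop (𝓝 0) := by
    have hg0 : 0 < Γ / T₁ := hx.trans_le hxg
    refine squeeze_zero (fun n => (Real.exp_pos _).le) (fun n => Real.exp_le_exp.2 ?_)
      (Real.tendsto_exp_neg_atTop_nhds_zero.comp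
        (tendsto_natCast_atTop_atTop.atTop_mul_const hg0))
    have := mul_nonneg hg0.le (sq_nonneg (n : ℝ))
    have := mul_nonneg hg0.le (n.cast_nonneg (α := ℝ))
    linarith
  have hyc : ContinuousOn (fun t => Real.exp (lam * t) • z t - ζ) (Icc 0 T) :=
    (ContinuousOn.smul (by fun_prop) hz.cont).sub continuousOn_const
  have hlim : Tendsto (fun n => Real.exp (lam * a n) • z (a n) - ζ) atTop
      (𝓝 (Real.exp (lam * t') • z t' - ζ)) := by
    have h1 := hyc t' ⟨ht'0, hT₁T⟩
    exact h1.tendsto.comp (tendsto_nhdsWithin_iff.2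
      ⟨tendsto_switchTime T₁, .of_forall fun n => ⟨ha0 n, haT n⟩⟩)
  have hzero : Real.exp (lam * t') • z t' - ζ = 0 :=
    tendsto_nhds_unique hlim (squeeze_zero_norm hzv hb_lim)
  -- Restart at t': both the deviation there and the later control are zero.
  refine sub_eq_zero.1 (hP.total _ fun μ => ?_)
  rw [hz.restart (hp_mem.restrict _) hζ ht'0 hT₁T le_rfl μ, hzero, map_zero, smul_zero, zero_sub,
    neg_eq_zero]
  refine intervalIntegral.integral_zero_ae (.of_forall fun s hs => ?_)
  rw [uIoc_of_le hT₁T] at hs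
  rw [hp_stop s hs.1, zero_smul, map_zero, smul_zero]

end

/-! ### Translation between mild solutions and modal solutions. -/

section

variable {X : Type*} [NormedAddCommGroup X] [InnerProductSpace ℝ X] [CompleteSpace X]
  {A : X →ₗ.[ℝ] X}

namespace IsNonnegSelfAdjointCompactResolvent

theorem eigenProj_spectralOp (hA : IsNonnegSelfAdjointCompactResolvent A) {f : ℝ → ℝ} {x : X}
    (hx : x ∈ spectralDomain A f) (μ : ℝ) :
    eigenProj A μ (spectralOp A f x) = f μ • eigenProj A μ x := by
  have hP := hA.spectralFamily
  have hc : ∀ μ, eigenProj A μ (f μ • eigenProj A μ x) = f μ • eigenProj A μ x := fun μ => by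
    rw [map_smul, hP.idem]
  refine hP.apply_tsum hc (hP.summable hc ?_) μ
  have h : Summable fun μ : ℝ => f μ ^ 2 * ‖eigenProj A μ x‖ ^ 2 := hx
  simpa only [norm_smul, mul_pow, Real.norm_eq_abs, sq_abs] using h

theorem eigenProj_sqrtOp (hA : IsNonnegSelfAdjointCompactResolvent A) {x : X}
    (hx : x ∈ sqrtDomain A) (μ : ℝ) :
    eigenProj A μ (sqrtOp A x) = Real.sqrt μ • eigenProj A μ x :=
  hA.eigenProj_spectralOp hx μ

theorem eigenProj_semigroup (hA : IsNonnegSelfAdjointCompactResolvent A) {t : ℝ} (ht : 0 ≤ t)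
    (x : X) (μ : ℝ) :
    eigenProj A μ (semigroup A t x) = Real.exp (-(μ * t)) • eigenProj A μ x := by
  refine hA.eigenProj_spectralOp ?_ μ
  refine (hA.spectralFamily.summable_norm_sq x).of_nonneg_of_le (fun _ => by positivity) fun μ => ?_
  by_cases h : eigenProj A μ = 0
  · simp [h]
  · refine mul_le_of_le_one_left (by positivity) (pow_le_one₀ (Real.exp_pos _).le ?_)
    rw [Real.exp_le_one_iff]
    have := mul_nonneg (hA.nonneg_of_eigenProj_ne_zero h) ht
    linarith

theorem norm_semigroup_sub_le (hA : IsNonnegSelfAdjointCompactResolvent A) {t : ℝ} (ht : 0 ≤ t)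
    (x y : X) : ‖semigroup A t x - semigroup A t y‖ ≤ ‖x - y‖ := by
  refine hA.spectralFamily.norm_le_of_forall fun μ => ?_
  rw [map_sub, hA.eigenProj_semigroup ht, hA.eigenProj_semigroup ht, ← smul_sub, ← map_sub]
  by_cases h : eigenProj A μ = 0
  · simp [h]
  · rw [norm_smul, Real.norm_of_nonneg (Real.exp_pos _).le]
    refine mul_le_of_le_one_left (norm_nonneg _) (Real.exp_le_one_iff.2 ?_)
    have := mul_nonneg (hA.nonneg_of_eigenProj_ne_zero h) ht
    linarith

theorem semigroup_zero_right (hA : IsNonnegSelfAdjointCompactResolvent A) {t : ℝ} (ht : 0 ≤ t) :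
    semigroup A t 0 = 0 :=
  hA.spectralFamily.ext fun μ => by rw [hA.eigenProj_semigroup ht]; simp

/-- Strong continuity together with contractivity gives joint continuity, needed for the
measurability of s ↦ e^{-(t-s)A} f(s). Truncating time at 0 avoids unbounded backward evolution. -/
theorem continuous_semigroup (hA : IsNonnegSelfAdjointCompactResolvent A) :
    Continuous fun rx : ℝ × X => semigroup A (max rx.1 0) rx.2 := by
  have hP := hA.spectralFamily
  have hstrong : ∀ x, Continuous fun r : ℝ => semigroup A (max r 0) x := by
    intro x
    obtain ⟨y, hyc, hy⟩ := hP.exists_orbit (fun μ h => hA.nonneg_of_eigenProj_ne_zero h) x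
    have heq : ∀ r : ℝ, semigroup A (max r 0) x = y (max r 0) := fun r =>
      hP.ext fun μ => by
        rw [hA.eigenProj_semigroup (le_max_right _ _), hy _ (mem_Ici.2 (le_max_right r 0))]
    simp_rw [heq]
    exact hyc.comp_continuous (by fun_prop) fun r => mem_Ici.2 (le_max_right r 0)
  rw [continuous_iff_continuousAt]
  rintro ⟨r₀, x₀⟩
  rw [ContinuousAt, tendsto_iff_norm_sub_tendsto_zero]
  have h1 : Tendsto (fun rx : ℝ × X => ‖rx.2 - x₀‖ +
      ‖semigroup A (max rx.1 0) x₀ - semigroup A (max r₀ 0) x₀‖) (𝓝 (r₀, x₀)) (𝓝 0) := by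
    have hc : Continuous fun rx : ℝ × X => ‖rx.2 - x₀‖ +
        ‖semigroup A (max rx.1 0) x₀ - semigroup A (max r₀ 0) x₀‖ :=
      ((continuous_snd.sub continuous_const).norm).add
        ((((hstrong x₀).comp continuous_fst).sub continuous_const).norm)
    simpa using hc.tendsto (r₀, x₀)
  refine squeeze_zero (fun _ => norm_nonneg _) (fun rx => ?_) h1
  refine (norm_sub_le_norm_sub_add_norm_sub _ (semigroup A (max rx.1 0) x₀) _).trans ?_
  exact add_le_add (hA.norm_semigroup_sub_le (le_max_right _ _) _ _) le_rfl

theorem integrableOn_semigroup (hA : IsNonnegSelfAdjointCompactResolvent A) {t : ℝ}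
    {f : ℝ → X} (hf : IntegrableOn f (Ioc 0 t)) :
    IntegrableOn (fun s => semigroup A (t - s) (f s)) (Ioc 0 t) := by
  have hm : AEStronglyMeasurable (fun s => semigroup A (max (t - s) 0) (f s))
      (volume.restrict (Ioc 0 t)) :=
    hA.continuous_semigroup.comp_aestronglyMeasurable
      (AEStronglyMeasurable.prodMk
        (Continuous.aestronglyMeasurable (continuous_const.sub continuous_id)) hf.1)
  have hm' : AEStronglyMeasurable (fun s => semigroup A (t - s) (f s))
      (volume.restrict (Ioc 0 t)) := by
    refine hm.congr ?_
    filter_upwards [ae_restrict_mem measurableSet_Ioc] with s hs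
    rw [max_eq_left (sub_nonneg.2 hs.2)]
  refine Integrable.mono hf hm' ?_
  filter_upwards [ae_restrict_mem measurableSet_Ioc] with s hs
  have h := hA.norm_semigroup_sub_le (sub_nonneg.2 hs.2) (f s) 0
  rwa [hA.semigroup_zero_right (sub_nonneg.2 hs.2), sub_zero, sub_zero] at h

theorem eigenProj_integral_semigroup (hA : IsNonnegSelfAdjointCompactResolvent A) {t : ℝ}
    (ht : 0 ≤ t) {f : ℝ → X} (hf : IntegrableOn f (Ioc 0 t)) (μ : ℝ) :
    eigenProj A μ (∫ s in (0 : ℝ)..t, semigroup A (t - s) (f s)) =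
      ∫ s in (0 : ℝ)..t, Real.exp (-(μ * (t - s))) • eigenProj A μ (f s) := by
  rw [← (eigenProj A μ).intervalIntegral_comp_comm
    ((intervalIntegrable_iff_integrableOn_Ioc_of_le ht).2 (hA.integrableOn_semigroup hf))]
  refine intervalIntegral.integral_congr_ae (.of_forall fun s hs => ?_)
  rw [uIoc_of_le ht] at hs
  exact hA.eigenProj_semigroup (sub_nonneg.2 hs.2) _ _

end IsNonnegSelfAdjointCompactResolvent

theorem modeKernel_zero (μ r : ℝ) :
    modeKernel 0 μ r = Real.sqrt (1 + μ) * Real.exp (-(μ * r)) := by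
  rw [modeKernel, sub_zero]

theorem memLp_control {T : ℝ} (p : L2 T) : MemLp p 2 (volume.restrict (Ioc 0 T)) := by
  rw [← restrict_Ioo_eq_restrict_Ioc]
  exact Lp.memLp p

theorem norm_control_sq {T : ℝ} (p : L2 T) : ‖p‖ ^ 2 = ∫ s in Ioc 0 T, p s ^ 2 := by
  rw [← restrict_Ioo_eq_restrict_Ioc, ← real_inner_self_eq_norm_sq, L2.inner_def]
  refine integral_congr_ae (.of_forall fun s => ?_)
  simp [sq]

/-- `J` is the operator `(1 + A)^{-1/2}`. -/
def IsInvSqrt (A : X →ₗ.[ℝ] X) (J : X →L[ℝ] X) : Prop :=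
  ∀ μ z, eigenProj A μ (J z) = (Real.sqrt (1 + μ))⁻¹ • eigenProj A μ z

theorem IsNonnegSelfAdjointCompactResolvent.exists_isInvSqrt
    (hA : IsNonnegSelfAdjointCompactResolvent A) : ∃ J, IsInvSqrt A J ∧ ∀ z, ‖J z‖ ≤ ‖z‖ := by
  obtain ⟨J, hJ, hJ1⟩ := hA.spectralFamily.exists_multiplier
    (f := fun μ => (Real.sqrt (1 + μ))⁻¹) fun μ hμ => by
      have h := hA.nonneg_of_eigenProj_ne_zero hμ
      rw [abs_of_nonneg (by positivity)]
      exact inv_le_one_of_one_le₀ (Real.one_le_sqrt.2 (by linarith))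
  exact ⟨J, hJ, hJ1⟩

namespace IsInvSqrt

variable {J : X →L[ℝ] X}

theorem sqrt_smul_eigenProj (hJ : IsInvSqrt A J) (hA : IsNonnegSelfAdjointCompactResolvent A)
    (μ : ℝ) (z : X) : Real.sqrt (1 + μ) • eigenProj A μ (J z) = eigenProj A μ z := by
  by_cases h : eigenProj A μ = 0
  · simp [h]
  · have := hA.nonneg_of_eigenProj_ne_zero h
    have h0 : Real.sqrt (1 + μ) ≠ 0 := (Real.sqrt_pos.2 (by linarith)).ne'
    rw [hJ, smul_smul, mul_inv_cancel₀ h0, one_smul]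

theorem injective (hJ : IsInvSqrt A J) (hA : IsNonnegSelfAdjointCompactResolvent A)
    {z z' : X} (h : J z = J z') : z = z' :=
  hA.spectralFamily.ext fun μ => by
    rw [← hJ.sqrt_smul_eigenProj hA, h, hJ.sqrt_smul_eigenProj hA]

theorem norm_sq_split (hJ : IsInvSqrt A J) (hA : IsNonnegSelfAdjointCompactResolvent A)
    (μ : ℝ) (z : X) :
    ‖eigenProj A μ z‖ ^ 2 =
      ‖eigenProj A μ (J z)‖ ^ 2 + Real.sqrt μ ^ 2 * ‖eigenProj A μ (J z)‖ ^ 2 := by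
  by_cases h : eigenProj A μ = 0
  · simp [h]
  · have := hA.nonneg_of_eigenProj_ne_zero h
    rw [← hJ.sqrt_smul_eigenProj hA, norm_smul, mul_pow, Real.norm_eq_abs, sq_abs,
      Real.sq_sqrt (by linarith), Real.sq_sqrt this]
    ring

theorem mem_sqrtDomain (hJ : IsInvSqrt A J) (hA : IsNonnegSelfAdjointCompactResolvent A)
    (z : X) : J z ∈ sqrtDomain A :=
  (hA.spectralFamily.summable_norm_sq z).of_nonneg_of_le (fun _ => by positivity) fun μ => by
    rw [hJ.norm_sq_split hA μ z]
    linarith [sq_nonneg ‖eigenProj A μ (J z)‖]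

theorem halfNorm_apply (hJ : IsInvSqrt A J) (hA : IsNonnegSelfAdjointCompactResolvent A)
    (z : X) : halfNorm A (J z) = ‖z‖ := by
  have hP := hA.spectralFamily
  have h1 := hP.hasSum_norm_sq_apply (J z)
  have h2 := hP.hasSum_norm_sq_apply (sqrtOp A (J z))
  simp only [hA.eigenProj_sqrtOp (hJ.mem_sqrtDomain hA z), norm_smul, mul_pow, Real.norm_eq_abs,
    sq_abs] at h2
  have h3 := h1.add h2
  simp only [← hJ.norm_sq_split hA] at h3
  rw [halfNorm, h3.unique (hP.hasSum_norm_sq_apply z), Real.sqrt_sq (norm_nonneg _)]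

/-- The inverse `(1 + A)^{1/2} = J + N A^{1/2}`, where `N` is a bounded operator with
`A^{1/2} J = N`. -/
theorem exists_sqrt (hJ : IsInvSqrt A J) (hA : IsNonnegSelfAdjointCompactResolvent A) :
    ∃ N : X →L[ℝ] X, (∀ z, sqrtOp A (J z) = N z) ∧
      ∀ x ∈ sqrtDomain A, J (J x + N (sqrtOp A x)) = x := by
  have hP := hA.spectralFamily
  obtain ⟨N, hN, -⟩ := hP.exists_multiplier
    (f := fun μ => Real.sqrt μ * (Real.sqrt (1 + μ))⁻¹) fun μ hμ => by
      have h := hA.nonneg_of_eigenProj_ne_zero hμ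
      rw [abs_of_nonneg (by positivity), ← div_eq_mul_inv]
      exact div_le_one_of_le₀ (Real.sqrt_le_sqrt (by linarith)) (Real.sqrt_nonneg _)
  refine ⟨N, fun z => hP.ext fun μ => ?_, fun x hx => hP.ext fun μ => ?_⟩
  · rw [hA.eigenProj_sqrtOp (hJ.mem_sqrtDomain hA z), hN, hJ, smul_smul]
  · by_cases h : eigenProj A μ = 0
    · simp [h]
    · have h0 := hA.nonneg_of_eigenProj_ne_zero h
      have h1 : Real.sqrt (1 + μ) ≠ 0 := (Real.sqrt_pos.2 (by linarith)).ne'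
      rw [hJ, map_add, hN, hJ, hA.eigenProj_sqrtOp hx, smul_smul, ← add_smul, smul_smul]
      -- On each mode this is (1 + μ)⁻¹ (1 + μ) = 1, with 1 + μ split as in J + N A^{1/2}.
      have h2 : (Real.sqrt (1 + μ))⁻¹ * ((Real.sqrt (1 + μ))⁻¹ +
          Real.sqrt μ * (Real.sqrt (1 + μ))⁻¹ * Real.sqrt μ) = 1 := by
        field_simp
        rw [Real.sq_sqrt h0, Real.sq_sqrt (by linarith)]
      rw [h2, one_smul]

/-- The bounded operator `B (1 + A)^{-1/2}`. -/
theorem exists_comp (hJ : IsInvSqrt A J) (hA : IsNonnegSelfAdjointCompactResolvent A)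
    {B : X →ₗ.[ℝ] X} (hAB : sqrtDomain A ⊆ (B.domain : Set X)) {CB : ℝ}
    (hB : ∀ x ∈ sqrtDomain A, ‖opApply B x‖ ≤ CB * halfNorm A x) :
    ∃ C : X →L[ℝ] X, (∀ z, C z = opApply B (J z)) ∧ ∀ z, ‖C z‖ ≤ CB * ‖z‖ := by
  have hmem : ∀ z, J z ∈ B.domain := fun z => hAB (hJ.mem_sqrtDomain hA z)
  have happ : ∀ z, opApply B (J z) = B ⟨J z, hmem z⟩ := fun z => dif_pos (hmem z)
  have hnorm : ∀ z, ‖opApply B (J z)‖ ≤ CB * ‖z‖ := fun z => by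
    rw [← hJ.halfNorm_apply hA z]
    exact hB _ (hJ.mem_sqrtDomain hA z)
  let L : X →ₗ[ℝ] X :=
    { toFun := fun z => opApply B (J z)
      map_add' := fun x y => by
        have h : (⟨J (x + y), hmem _⟩ : B.domain) = ⟨J x, hmem x⟩ + ⟨J y, hmem y⟩ :=
          Subtype.ext (map_add J x y)
        rw [happ, happ, happ, h, LinearPMap.map_add]
      map_smul' := fun r x => by
        have h : (⟨J (r • x), hmem _⟩ : B.domain) = r • ⟨J x, hmem x⟩ :=
          Subtype.ext (map_smul J r x)
        rw [happ, happ, h, LinearPMap.map_smul, RingHom.id_apply] }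
  exact ⟨L.mkContinuous CB hnorm, fun _ => rfl, hnorm⟩

variable {B : X →ₗ.[ℝ] X} {C : X →L[ℝ] X} {T : ℝ} {p : L2 T} {z₀ : X}

theorem isMildSolution (hJ : IsInvSqrt A J) (hA : IsNonnegSelfAdjointCompactResolvent A)
    (hC : ∀ z, C z = opApply B (J z)) {z : ℝ → X}
    (hz : IsModalSolution (eigenProj A) C p T z₀ z) :
    IsMildSolution A B T (J z₀) p fun t => J (z t) := by
  obtain ⟨N, hN, -⟩ := hJ.exists_sqrt hA
  refine ⟨fun t _ => hJ.mem_sqrtDomain hA _, J.continuous.comp_continuousOn hz.cont, ?_,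
    fun t ht => hA.spectralFamily.ext fun μ => ?_⟩
  · simp only [hN]
    exact N.continuous.comp_continuousOn hz.cont
  · have hint : IntegrableOn (fun s => p s • opApply B (J (z s))) (Ioc 0 t) := by
      simp only [← hC]
      exact ((memLp_smul_of_continuousOn (memLp_control p) (C.continuous.comp_continuousOn
        hz.cont)).integrable one_le_two).mono_measure
          (Measure.restrict_mono (Ioc_subset_Ioc_right ht.2) le_rfl)
    rw [map_sub, hA.eigenProj_semigroup ht.1, hA.eigenProj_integral_semigroup ht.1 hint, hJ,
      hz.eq t ht, smul_sub, hJ, smul_comm, ← intervalIntegral.integral_smul]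
    congr 1
    refine intervalIntegral.integral_congr fun s _ => ?_
    simp only [← hC]
    by_cases h : eigenProj A μ = 0
    · simp [h]
    · have h0 := hA.nonneg_of_eigenProj_ne_zero h
      have h1 : Real.sqrt (1 + μ) ≠ 0 := (Real.sqrt_pos.2 (by linarith)).ne'
      rw [modeKernel_zero, smul_smul, ← mul_assoc, inv_mul_cancel₀ h1, one_mul]

/-- Since z is assembled from u and A^{1/2} u by bounded operators, continuity of u in D(A^{1/2}) is
what makes z continuous. Thus uniqueness for the modal equation covers every mild solution. -/
theorem exists_isModalSolution (hJ : IsInvSqrt A J)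
    (hA : IsNonnegSelfAdjointCompactResolvent A) (hC : ∀ z, C z = opApply B (J z)) {u : ℝ → X}
    (hu : IsMildSolution A B T (J z₀) p u) :
    ∃ z, IsModalSolution (eigenProj A) C p T z₀ z ∧ ∀ t ∈ Icc 0 T, J (z t) = u t := by
  obtain ⟨N, -, hN⟩ := hJ.exists_sqrt hA
  set z : ℝ → X := fun t => J (u t) + N (sqrtOp A (u t)) with hz
  have hJz : ∀ t ∈ Icc 0 T, J (z t) = u t := fun t ht => hN _ (hu.mem t ht)
  have hzc : ContinuousOn z (Icc 0 T) :=
    (J.continuous.comp_continuousOn hu.cont).add (N.continuous.comp_continuousOn hu.cont_sqrt)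
  refine ⟨z, ⟨hzc, fun t ht μ => ?_⟩, hJz⟩
  have hCz : ∀ s ∈ Icc 0 t, C (z s) = opApply B (u s) := fun s hs => by
    rw [hC, hJz s ⟨hs.1, hs.2.trans ht.2⟩]
  have hint : IntegrableOn (fun s => p s • opApply B (u s)) (Ioc 0 t) := by
    refine IntegrableOn.congr_fun (((memLp_smul_of_continuousOn (memLp_control p)
      (C.continuous.comp_continuousOn hzc)).integrable one_le_two).mono_measure
        (Measure.restrict_mono (Ioc_subset_Ioc_right ht.2) le_rfl)) (fun s hs => ?_)
        measurableSet_Ioc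
    simp only [Function.comp_apply]
    rw [hCz s (Ioc_subset_Icc_self hs)]
  rw [← hJ.sqrt_smul_eigenProj hA, hJz t ht, hu.eq t ht, map_sub, hA.eigenProj_semigroup ht.1,
    hA.eigenProj_integral_semigroup ht.1 hint, smul_sub, smul_comm, hJ.sqrt_smul_eigenProj hA,
    ← intervalIntegral.integral_smul]
  congr 1
  refine intervalIntegral.integral_congr fun s hs => ?_
  rw [uIcc_of_le ht.1] at hs
  simp only [hCz s hs]
  rw [modeKernel_zero, smul_smul]

end IsInvSqrt

end

/-! ### From the control cost to near-optimal controls, and the constant D. -/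

section

variable {X : Type*} [NormedAddCommGroup X] [InnerProductSpace ℝ X] [CompleteSpace X]
  {A : X →ₗ.[ℝ] X}

/-- A bound on the control cost provides controls that are optimal up to a factor `c > 1`. -/
theorem exists_control_of_controlCost_le {b : X} {τ κ c : ℝ}
    (hcost : controlCost A b τ ≤ ENNReal.ofReal κ) (hκ : 0 < κ) (hc : 1 < c) {y₀ : X}
    (hy : ‖y₀‖ = 1) : ∃ p : L2 τ, linearSolutionAt A b τ y₀ p = 0 ∧ ‖p‖ ≤ c * κ := by
  -- The infimum need not be attained as far as the argument knows; the margin c > 1 makes the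
  -- inequality strict and yields an actual control.
  have h1 : ⨅ (p : L2 τ) (_ : linearSolutionAt A b τ y₀ p = 0), ‖p‖ₑ < ENNReal.ofReal (c * κ) := by
    refine lt_of_le_of_lt ?_ ((ENNReal.ofReal_lt_ofReal_iff (by positivity)).2
      (lt_mul_of_one_lt_left hκ hc))
    exact (le_iSup₂ (f := fun (y₀ : X) (_ : ‖y₀‖ = 1) =>
      ⨅ (p : L2 τ) (_ : linearSolutionAt A b τ y₀ p = 0), ‖p‖ₑ) y₀ hy).trans hcost
  simp only [iInf_lt_iff] at h1
  obtain ⟨p, hp, hlt⟩ := h1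
  refine ⟨p, hp, ?_⟩
  rw [← ofReal_norm, ENNReal.ofReal_lt_ofReal_iff (by positivity)] at hlt
  exact hlt.le

theorem IsNonnegSelfAdjointCompactResolvent.modes_of_linearSolutionAt_eq_zero
    (hA : IsNonnegSelfAdjointCompactResolvent A) {b y₀ : X} {τ : ℝ} (hτ : 0 ≤ τ) {p : L2 τ}
    (h : linearSolutionAt A b τ y₀ p = 0) (μ : ℝ) :
    Real.exp (-(μ * τ)) • eigenProj A μ y₀ =
      ∫ s in (0 : ℝ)..τ, Real.exp (-(μ * (τ - s))) • eigenProj A μ (p s • b) := by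
  have hint : IntegrableOn (fun s => p s • b) (Ioc 0 τ) :=
    ((memLp_control p).integrable one_le_two).smul_const b
  have h1 := congrArg (eigenProj A μ) h
  rw [linearSolutionAt, map_sub, map_zero, hA.eigenProj_semigroup hτ,
    hA.eigenProj_integral_semigroup hτ hint, sub_eq_zero] at h1
  exact h1

/-- Null controllability of the shifted linearized equation for the variable `(1 + A)^{1/2} y`. -/
theorem IsInvSqrt.exists_null_control {J : X →L[ℝ] X} (hJ : IsInvSqrt A J)
    (hA : IsNonnegSelfAdjointCompactResolvent A) (hJ1 : ∀ z, ‖J z‖ ≤ ‖z‖) {b : X}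
    {τ lam κ c : ℝ} (hτ : 0 < τ) (hlam : 0 ≤ lam) (hκ : 0 < κ) (hc : 1 < c)
    (hcost : controlCost A b τ ≤ ENNReal.ofReal κ) (v : X) :
    ∃ q : ℝ → ℝ, MemLp q 2 volume ∧ (∀ s, s ∉ Ioc 0 τ → q s = 0) ∧
      ∫ s, q s ^ 2 ≤ (c * (Real.exp (lam * τ) * κ) * ‖v‖) ^ 2 ∧
      ∀ μ, Real.exp (-((μ - lam) * τ)) • eigenProj A μ v =
        ∫ s in (0 : ℝ)..τ, modeKernel lam μ (τ - s) • eigenProj A μ (q s • b) := by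
  set y := J v with hy
  -- The cost concerns unit vectors, so y is normalized, and y = 0 is treated apart.
  by_cases hy0 : y = 0
  · have hv : v = 0 := hJ.injective hA (by rw [← hy, hy0, map_zero])
    refine ⟨0, MemLp.zero, fun _ _ => rfl, ?_, fun μ => ?_⟩
    · simp only [Pi.zero_apply, ne_eq, OfNat.ofNat_ne_zero, not_false_eq_true, zero_pow,
        integral_zero]
      positivity
    · simp [hv]
  · have hn : 0 < ‖y‖ := norm_pos_iff.2 hy0
    obtain ⟨p, hp0, hpn⟩ := exists_control_of_controlCost_le hcost hκ hc
      (y₀ := ‖y‖⁻¹ • y) (by rw [norm_smul, norm_inv, norm_norm, inv_mul_cancel₀ hn.ne'])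
    have hmodes := hA.modes_of_linearSolutionAt_eq_zero hτ.le hp0
    have hw : ContinuousOn (fun s => ‖y‖ * Real.exp (lam * s)) (Icc 0 τ) := by fun_prop
    have hmem : MemLp (fun s => p s * (‖y‖ * Real.exp (lam * s))) 2
        (volume.restrict (Ioc 0 τ)) :=
      memLp_smul_of_continuousOn (memLp_control p) hw
    -- The factor ‖y‖ undoes the normalization and exp(lam s) passes to the shifted equation; the
    -- latter costs at most exp(lam τ).
    refine ⟨(Ioc 0 τ).indicator fun s => p s * (‖y‖ * Real.exp (lam * s)),
      (memLp_indicator_iff_restrict measurableSet_Ioc).2 hmem,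
      fun s hs => indicator_of_notMem hs _, ?_, fun μ => ?_⟩
    · have h1 : ∀ s, (Ioc 0 τ).indicator (fun s => p s * (‖y‖ * Real.exp (lam * s))) s ^ 2 =
          (Ioc 0 τ).indicator (fun s => (p s * (‖y‖ * Real.exp (lam * s))) ^ 2) s := fun s => by
        by_cases hs : s ∈ Ioc 0 τ
        · simp only [indicator_of_mem hs]
        · simp only [indicator_of_notMem hs]; simp
      simp only [h1]
      rw [integral_indicator measurableSet_Ioc]
      calc ∫ s in Ioc 0 τ, (p s * (‖y‖ * Real.exp (lam * s))) ^ 2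
          ≤ ∫ s in Ioc 0 τ, (‖y‖ * Real.exp (lam * τ)) ^ 2 * p s ^ 2 := by
            refine setIntegral_mono_on hmem.integrable_sq
              ((memLp_control p).integrable_sq.const_mul _) measurableSet_Ioc fun s hs => ?_
            rw [mul_pow, mul_comm]
            refine mul_le_mul_of_nonneg_right (pow_le_pow_left₀ (by positivity) ?_ 2)
              (sq_nonneg _)
            exact mul_le_mul_of_nonneg_left (Real.exp_le_exp.2
              (mul_le_mul_of_nonneg_left hs.2 hlam)) (norm_nonneg _)
        _ = (‖y‖ * Real.exp (lam * τ)) ^ 2 * ‖p‖ ^ 2 := by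
            rw [integral_const_mul, norm_control_sq]
        _ = (‖p‖ * Real.exp (lam * τ) * ‖y‖) ^ 2 := by ring
        _ ≤ (c * (Real.exp (lam * τ) * κ) * ‖v‖) ^ 2 := by
            refine pow_le_pow_left₀ (by positivity) ?_ 2
            have h2 : c * (Real.exp (lam * τ) * κ) = c * κ * Real.exp (lam * τ) := by ring
            rw [h2]
            exact mul_le_mul (mul_le_mul_of_nonneg_right hpn (Real.exp_pos _).le) (hJ1 v)
              (norm_nonneg _) (by positivity)
    · have h1 := congrArg
        (fun w => (‖y‖ * Real.sqrt (1 + μ) * Real.exp (lam * τ)) • w) (hmodes μ)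
      simp only [← intervalIntegral.integral_smul] at h1
      have h2 : (‖y‖ * Real.sqrt (1 + μ) * Real.exp (lam * τ)) •
          Real.exp (-(μ * τ)) • eigenProj A μ (‖y‖⁻¹ • y) =
          Real.exp (-((μ - lam) * τ)) • eigenProj A μ v := by
        rw [← hJ.sqrt_smul_eigenProj hA μ v, map_smul, smul_smul, smul_smul, smul_smul]
        congr 1
        have h3 : Real.exp (-((μ - lam) * τ)) = Real.exp (lam * τ) * Real.exp (-(μ * τ)) := by
          rw [← Real.exp_add]; ring_nf
        rw [h3]
        field_simp
      rw [← h2, h1]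
      refine intervalIntegral.integral_congr_ae (.of_forall fun s hs => ?_)
      rw [uIoc_of_le hτ.le] at hs
      have h3 : modeKernel lam μ (τ - s) * Real.exp (lam * s) =
          Real.sqrt (1 + μ) * Real.exp (lam * τ) * Real.exp (-(μ * (τ - s))) := by
        rw [modeKernel, mul_assoc, mul_assoc, ← Real.exp_add, ← Real.exp_add]
        ring_nf
      simp only [indicator_of_mem hs, map_smul, smul_smul]
      congr 1
      linear_combination -(p s * ‖y‖) * h3

/-- Here exp(lam) ≥ 1 + lam absorbs the growth of the smoothing constant in lam, and exp(max(log D,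
0)) ≥ D absorbs the powers of CB. -/
theorem constD_bounds {CB lam : ℝ} (hCB : 0 < CB) (hlam : 0 ≤ lam) :
    6 * (Real.sqrt (3 / 2 + lam) * CB) ≤
      Real.exp (lam + max (Real.log (constD CB lam)) 0) ∧
    3 * (Real.sqrt (3 / 2 + lam) * CB) *
        (1 + Real.sqrt (3 / 2 + lam) * CB * Real.sqrt (1 + lam)) ≤
      Real.exp (lam + max (Real.log (constD CB lam)) 0) := by
  set M := max (1 + 3 / 2 * CB ^ 2) (CB ^ 2 / 2 * (1 + Real.sqrt lam) ^ 2 * (5 + 3 * CB ^ 2))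
    with hM
  set E := Real.exp lam with hE
  set κ := Real.sqrt (3 / 2 + lam) with hκ
  have hsl : 0 ≤ Real.sqrt lam := Real.sqrt_nonneg _
  have hE1 : 1 + lam ≤ E := by linarith [Real.add_one_le_exp lam]
  have hE0 : 0 < E := Real.exp_pos _
  have hκ0 : 0 ≤ κ := Real.sqrt_nonneg _
  have hκ2 : κ ^ 2 = 3 / 2 + lam := Real.sq_sqrt (by linarith)
  have hκE : κ ≤ 5 / 4 * E := by
    refine Real.sqrt_le_iff.2 ⟨by positivity, ?_⟩
    nlinarith
  have hM1 : 1 ≤ Real.sqrt M := Real.one_le_sqrt.2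
    (le_max_of_le_left (by nlinarith [sq_nonneg CB]))
  have hM2 : 3 / 2 * (CB * (1 + Real.sqrt lam)) ≤ Real.sqrt M := by
    refine Real.le_sqrt_of_sq_le (le_max_of_le_right ?_)
    have h : 0 ≤ CB ^ 2 * (1 + Real.sqrt lam) ^ 2 := by positivity
    nlinarith [mul_nonneg h (sq_nonneg CB)]
  have h2 : (1.414 : ℝ) ≤ Real.sqrt 2 := Real.le_sqrt_of_sq_le (by norm_num)
  have he : (2.718 : ℝ) ≤ Real.exp (CB * (5 / 4 * CB + 1) + 1) := by
    have h := Real.exp_one_gt_d9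
    have h' : Real.exp 1 ≤ Real.exp (CB * (5 / 4 * CB + 1) + 1) :=
      Real.exp_le_exp.2 (by linarith [mul_pos hCB (by positivity : 0 < 5 / 4 * CB + 1)])
    linarith
  -- Numerically 2 · 1.414 · 2.718 > 7.6, just above the 6 · 5/4 = 7.5 required for the first bound.
  have hbase : 7.6 * CB ≤
      2 * Real.sqrt 2 * CB * Real.exp (CB * (5 / 4 * CB + 1) + 1) := by
    have h3 : (7.6 : ℝ) ≤ 2 * Real.sqrt 2 * Real.exp (CB * (5 / 4 * CB + 1) + 1) := by
      nlinarith
    calc 7.6 * CB ≤ 2 * Real.sqrt 2 * Real.exp (CB * (5 / 4 * CB + 1) + 1) * CB :=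
          mul_le_mul_of_nonneg_right h3 hCB.le
      _ = _ := by ring
  have hD1 : 7.6 * CB ≤ constD CB lam := by
    refine hbase.trans (le_mul_of_one_le_right (by positivity) hM1)
  have hD2 : 7.6 * CB * (3 / 2 * (CB * (1 + Real.sqrt lam))) ≤ constD CB lam :=
    mul_le_mul hbase hM2 (by positivity) (by positivity)
  have hD0 : 0 < constD CB lam := by linarith
  have hDE : E * constD CB lam ≤ Real.exp (lam + max (Real.log (constD CB lam)) 0) := by
    rw [Real.exp_add]
    refine mul_le_mul_of_nonneg_left ?_ hE0.le
    exact (Real.exp_log hD0).symm.trans_le (Real.exp_le_exp.2 (le_max_left _ _))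
  have hZ : Real.sqrt (1 + lam) ≤ 1 + Real.sqrt lam :=
    Real.sqrt_le_iff.2 ⟨by positivity, by nlinarith [Real.sq_sqrt hlam]⟩
  have h1 : κ * CB ≤ 5 / 4 * E * CB := mul_le_mul_of_nonneg_right hκE hCB.le
  have hED1 := mul_le_mul_of_nonneg_left hD1 hE0.le
  have hED2 := mul_le_mul_of_nonneg_left hD2 hE0.le
  have hpos : 0 ≤ E * CB := by positivity
  refine ⟨?_, ?_⟩
  · linarith
  · have h4 : κ ^ 2 * CB ^ 2 * Real.sqrt (1 + lam) ≤
        (3 / 2 * E) * CB ^ 2 * (1 + Real.sqrt lam) := by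
      rw [hκ2]
      refine mul_le_mul (mul_le_mul_of_nonneg_right ?_ (sq_nonneg _)) hZ (Real.sqrt_nonneg _)
        (by positivity)
      linarith
    have h5 : 3 * (κ * CB) * (1 + κ * CB * Real.sqrt (1 + lam)) =
        3 * (κ * CB) + 3 * (κ ^ 2 * CB ^ 2 * Real.sqrt (1 + lam)) := by ring
    have h6 : 0 ≤ E * CB ^ 2 * (1 + Real.sqrt lam) := by positivity
    rw [h5]
    -- The mean of `hED1` and `hED2` suffices: 3.8 ≥ 15/4 and 5.7 ≥ 9/2.
    linarith

end

end BilinearControl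

/-! ### The main theorem: choice of parameters and return to u. -/

theorem mainTheorem1 {X : Type*} [NormedAddCommGroup X] [InnerProductSpace ℝ X] [CompleteSpace X]
    [TopologicalSpace.SeparableSpace X]
    (A B : X →ₗ.[ℝ] X)
    (hA : BilinearControl.IsNonnegSelfAdjointCompactResolvent A)
    -- the first eigenvalue and a normalized eigenvector
    (lam : ℝ) (φ : X) (hφ : φ ∈ BilinearControl.eigenspace A lam) (hφ_norm : ‖φ‖ = 1)
    (hlam : ∀ μ : ℝ, BilinearControl.eigenspace A μ ≠ ⊥ → lam ≤ μ)
    -- the embedding of the domain of the square root of `A` in the domain of `B`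
    (hAB : BilinearControl.sqrtDomain A ⊆ (B.domain : Set X))
    (CB : ℝ) (hCB : 0 < CB)
    (hB : ∀ x ∈ BilinearControl.sqrtDomain A,
      ‖BilinearControl.opApply B x‖ ≤ CB * BilinearControl.halfNorm A x)
    -- null controllability in any positive time, and the bound on the control cost
    (hctrl : ∀ T : ℝ, 0 < T →
      BilinearControl.NullControllable A (BilinearControl.opApply B φ) T)
    (ν T₀ : ℝ) (hν : 0 < ν) (hT₀ : 0 < T₀)
    (hcost : ∀ τ : ℝ, 0 < τ → τ ≤ T₀ →
      BilinearControl.controlCost A (BilinearControl.opApply B φ) τ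
        ≤ ENNReal.ofReal (Real.exp (ν / τ)))
    (T : ℝ) (hT : 0 < T) :
    0 < BilinearControl.radius ν T₀ CB lam T ∧
    ∀ u₀ ∈ BilinearControl.sqrtDomain A,
      BilinearControl.halfNorm A (u₀ - φ) < BilinearControl.radius ν T₀ CB lam T →
      ∃ p : BilinearControl.L2 T,
        ‖p‖ ^ 2 ≤
          Real.exp (-(Real.pi ^ 2 * BilinearControl.constGamma ν CB lam / T)) /
            (Real.exp (2 * Real.pi ^ 2 * BilinearControl.constGamma ν CB lam / (3 * T)) - 1) ∧
        (∃ u : ℝ → X, BilinearControl.IsMildSolution A B T u₀ p u) ∧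
        ∀ u : ℝ → X, BilinearControl.IsMildSolution A B T u₀ p u →
          u T = Real.exp (-(lam * T)) • φ := by
  open BilinearControl in
  refine ⟨Real.exp_pos _, fun u₀ hu₀ hdist => ?_⟩
  have hP := hA.spectralFamily
  have hφ0 : φ ≠ 0 := norm_ne_zero_iff.1 (by rw [hφ_norm]; exact one_ne_zero)
  have hPφ : eigenProj A lam φ = φ := eigenProj_apply_of_mem hφ
  have hlam0 : 0 ≤ lam := hA.nonneg_of_eigenProj_ne_zero (μ := lam) fun h => hφ0 <| by
    rw [← hPφ, h]; rfl
  have hlow : ∀ μ, eigenProj A μ ≠ 0 → lam ≤ μ := fun μ h =>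
    hlam μ (eigenspace_ne_bot_of_eigenProj_ne_zero h)
  have hPφ' : ∀ μ, μ ≠ lam → eigenProj A μ φ = 0 := fun μ h => by
    rw [← hPφ, hP.orth μ lam φ h]
  obtain ⟨J, hJ, hJ1⟩ := hA.exists_isInvSqrt
  obtain ⟨N, -, hN⟩ := hJ.exists_sqrt hA
  obtain ⟨C, hC, hC1⟩ := hJ.exists_comp hA hAB hB
  set ζ : X := Real.sqrt (1 + lam) • φ with hζ
  have hs0 : Real.sqrt (1 + lam) ≠ 0 := (Real.sqrt_pos.2 (by linarith)).ne'
  have hJζ : J ζ = φ := hP.ext fun μ => by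
    rw [hJ, hζ, map_smul, smul_smul]
    by_cases h : μ = lam
    · rw [h, inv_mul_cancel₀ hs0, one_smul]
    · rw [hPφ' μ h, smul_zero]
  have hζ0 : ∀ μ, μ ≠ lam → eigenProj A μ ζ = 0 := fun μ h => by
    rw [hζ, map_smul, hPφ' μ h, smul_zero]
  have hζn : ‖ζ‖ = Real.sqrt (1 + lam) := by
    rw [hζ, norm_smul, hφ_norm, mul_one, Real.norm_of_nonneg (Real.sqrt_nonneg _)]
  set z₀ : X := J u₀ + N (sqrtOp A u₀) with hz₀
  have hJz₀ : J z₀ = u₀ := hN u₀ hu₀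
  set Γ := constGamma ν CB lam with hΓ
  set L := max (Real.log (constD CB lam)) 0 with hL
  have hΓ0 : 0 < Γ := by
    have : 0 ≤ L := le_max_right _ _
    have h : Γ = 2 * ν + 3 * lam + L := rfl
    rw [h]; positivity
  set T₁ := timeT1 T T₀ with hT₁
  have hT₁0 : 0 < T₁ := lt_min (by positivity) (lt_min one_pos hT₀)
  have hT₁T : T₁ ≤ 6 / Real.pi ^ 2 * T := min_le_left _ _
  have hpi : 0 < Real.pi ^ 2 := by positivity
  have hT₁T' : T₁ * (Real.pi ^ 2 / 6) ≤ T := by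
    calc T₁ * (Real.pi ^ 2 / 6) ≤ 6 / Real.pi ^ 2 * T * (Real.pi ^ 2 / 6) :=
          mul_le_mul_of_nonneg_right hT₁T (by positivity)
      _ = T := by field_simp
  -- Chosen so that 6x and 4x are the two exponents in the control bound; x ≤ Γ/T₁ is equivalent to
  -- T₁π²/6 ≤ T.
  set x := Real.pi ^ 2 * Γ / (6 * T) with hx
  have hx0 : 0 < x := by positivity
  have hxg : x ≤ Γ / T₁ := by
    rw [hx, div_le_div_iff₀ (by positivity) hT₁0]
    calc Real.pi ^ 2 * Γ * T₁ = 6 * Γ * (T₁ * (Real.pi ^ 2 / 6)) := by ring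
      _ ≤ 6 * Γ * T := mul_le_mul_of_nonneg_left hT₁T' (by positivity)
      _ = Γ * (6 * T) := by ring
  -- The near-optimality factor: 3/2 is what the constants in `step_bounds` tolerate, and exp(x/2)
  -- is what the geometric series tolerates.
  set c := min (3 / 2) (Real.exp (x / 2)) with hc
  have hc1 : 1 < c := lt_min (by norm_num) (Real.one_lt_exp_iff.2 (by positivity))
  have hcx : c ^ 2 ≤ Real.exp x := by
    calc c ^ 2 ≤ Real.exp (x / 2) ^ 2 :=
          pow_le_pow_left₀ (by linarith) (min_le_right _ _) 2
      _ = Real.exp x := by rw [← Real.exp_nat_mul]; congr 1; push_cast; ring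
  have hD := constD_bounds hCB hlam0
  rw [← hζn] at hD
  have hdist' : ‖z₀ - ζ‖ ≤ Real.exp (-(6 * (Γ / T₁))) := by
    rw [← hJ.halfNorm_apply hA, map_sub, hJz₀, hJζ, ← mul_div_assoc]
    exact hdist.le
  obtain ⟨p, hp, hpn, hpz⟩ := hP.exists_control hlam0 hlow hC1 hCB.le hζ0 hν (le_max_right _ _)
    hc1.le (min_le_left _ _) hcx hx0 (rfl : Γ = 2 * ν + 3 * lam + L) hT₁0
    ((min_le_right _ _).trans (min_le_left _ _)) ((min_le_right _ _).trans (min_le_right _ _))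
    hT₁T' hxg hD.1 hD.2 (T₀ := T₀) (fun τ hτ hτ0 v => by
      have h := hJ.exists_null_control hA hJ1 hτ hlam0 (Real.exp_pos _) hc1 (hcost τ hτ hτ0) v
      rw [← Real.exp_add] at h
      have hCζ : C ζ = opApply B φ := by rw [hC, hJζ]
      rw [hCζ]
      exact h) hdist'
  set P : L2 T := (hp.restrict (Ioo 0 T)).toLp p with hPdef
  have hae : (P : ℝ → ℝ) =ᵐ[volume.restrict (Ioc 0 T)] p := by
    rw [← restrict_Ioo_eq_restrict_Ioc]
    exact MemLp.coeFn_toLp _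
  refine ⟨P, ?_, ?_, fun u hu => ?_⟩
  · have h6 : Real.pi ^ 2 * Γ / T = 6 * x := by rw [hx]; field_simp
    have h4 : 2 * Real.pi ^ 2 * Γ / (3 * T) = 4 * x := by rw [hx]; field_simp; norm_num
    rw [h6, h4]
    refine le_trans ?_ hpn
    rw [norm_control_sq, integral_congr_ae (g := fun s => p s ^ 2)
      (hae.mono fun s hs => by simp only [hs])]
    exact setIntegral_le_integral hp.integrable_sq (.of_forall fun s => sq_nonneg _)
  · obtain ⟨z, hz⟩ := hP.exists_modalSolution (C := C) (T := T)
      (fun μ h => hA.nonneg_of_eigenProj_ne_zero h) hT.le (memLp_control P) z₀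
    have h := hJ.isMildSolution hA hC hz
    rw [hJz₀] at h
    exact ⟨_, h⟩
  · rw [← hJz₀] at hu
    obtain ⟨z, hz, hzu⟩ := hJ.exists_isModalSolution hA hC hu
    have h1 := hpz z (hz.congr_control hae)
    have h2 : z T = Real.exp (-(lam * T)) • ζ := by
      rw [← h1, smul_smul, ← Real.exp_add, neg_add_cancel, Real.exp_zero, one_smul]
    rw [← hzu T ⟨hT.le, le_rfl⟩, h2, map_smul, hJζ]
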